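/- A \emph{multi-unit market with general valuations} consists of $n$ buyers and $m$ identical indivisible units of a good; buyer $i$ has a rational budget $B_i>0$ and an arbitrary vector of rational values $v_{i,0},v_{i,1},\dots,v_{i,m}$ with $v_{i,0}\ge 0$ (for instance $v_{i,0}=0$), where $v_{i,j}$ is its value for receiving $j$ units. At a price $p\ge 0$ per unit, the utility of buyer $i$ for $y\in\{0,\dots,m\}$ units is $u_i(p,y)=v_{i,y}-p\,y$ if $p\,y\le B_i$ and $-\infty$ otherwise, and its demand set $D_i(p)$ consists of the affordable $y$ ($p\,y\le B_i$) that maximize $u_i(p,\cdot)$ over $\{0,\dots,m\}$. A pair $(p,x)$ of a real price $p\ge 0$ and an allocation $x=(x_1,\dots,x_n)$ with $\sum_i x_i\le m$ is an \emph{envy-free pricing} if $x_i\in D_i(p)$ for every $i$. Its social welfare is $\sum_i v_{i,x_i}$ and its revenue is $\sum_i x_i\,p$. \textbf{Theorem.} For each of the two objectives, social welfare and revenue, there is a fully polynomial time approximation scheme for computing an optimal envy-free pricing of a multi-unit market with general valuations. That is, for each of the two objectives there is a single algorithm that, for every such market (given by the binary encodings of $n$, $m$, all the $B_i$ and all the $v_{i,j}$)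 and every $\epsilon>0$ (given through the integer $\lceil 1/\epsilon\rceil$), outputs an envy-free pricing $(p,x)$ with rational price $p$ whose objective value is at least $(1-\epsilon)$ times that of every envy-free pricing of the market, in time polynomial in the bit length of the market's encoding (in which all $n(m+1)$ values are listed) and in $1/\epsilon$. Time is measured as the logarithmic cost of a program on a random access machine with integer registers and arrays. -/

import Mathlib

/-! ### Machine model: while-programs on a random access machine with logarithmic cost -/

namespace RAM

/-- Arithmetic expressions over integer registers and integer arrays. `read a e` is the cell of
array `a` whose address is the value of `e` (indirect addressing). -/
inductive Expr : Type
  | const (z : ℤ) : Expr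
  | reg (r : ℕ) : Expr
  | read (a : ℕ) (e : Expr) : Expr
  | add (e f : Expr) : Expr
  | sub (e f : Expr) : Expr
  | mul (e f : Expr) : Expr
  | div (e f : Expr) : Expr

/-- Programs. The tests of `cond` and `loop` ask whether the value of an expression is positive. -/
inductive Cmd : Type
  | skip : Cmd
  | assign (r : ℕ) (e : Expr) : Cmd
  | store (a : ℕ) (idx e : Expr) : Cmd
  | seq (c d : Cmd) : Cmd
  | cond (e : Expr) (c d : Cmd) : Cmd
  | loop (e : Expr) (c : Cmd) : Cmd

/-- The contents of the registers and of the arrays. A program mentions only finitely many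
registers and arrays. -/
structure State where
  reg : ℕ → ℤ
  arr : ℕ → ℤ → ℤ

/-- The number of bits of `|z|`. -/
def bits (z : ℤ) : ℕ := Nat.size z.natAbs

/-- Value of an expression. Division rounds down for a positive divisor, and `x / 0 = 0`. -/
def Expr.eval (s : State) : Expr → ℤ
  | .const z => z
  | .reg r => s.reg r
  | .read a e => s.arr a (e.eval s)
  | .add e f => e.eval s + f.eval s
  | .sub e f => e.eval s - f.eval s
  | .mul e f => e.eval s * f.eval s
  | .div e f => e.eval s / f.eval s

/-- Logarithmic cost of evaluating an expression: every node of the expression (so also every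
operand and every address) is charged one plus the number of bits of its value. -/
def Expr.cost (s : State) : Expr → ℕ
  | .const z => bits z + 1
  | .reg r => bits (s.reg r) + 1
  | .read a e => e.cost s + bits ((Expr.read a e).eval s) + 1
  | .add e f => e.cost s + f.cost s + bits ((Expr.add e f).eval s) + 1
  | .sub e f => e.cost s + f.cost s + bits ((Expr.sub e f).eval s) + 1
  | .mul e f => e.cost s + f.cost s + bits ((Expr.mul e f).eval s) + 1
  | .div e f => e.cost s + f.cost s + bits ((Expr.div e f).eval s) + 1

def State.setReg (s : State) (r : ℕ) (z : ℤ) : State :=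
  { s with reg := Function.update s.reg r z }

def State.setArr (s : State) (a : ℕ) (k z : ℤ) : State :=
  { s with arr := Function.update s.arr a (Function.update (s.arr a) k z) }

/-- `Exec c s s' t`: started in state `s`, program `c` halts in state `s'` after total cost `t`. -/
inductive Exec : Cmd → State → State → ℕ → Prop
  | skip (s : State) : Exec .skip s s 1
  | assign (r : ℕ) (e : Expr) (s : State) :
      Exec (.assign r e) s (s.setReg r (e.eval s)) (e.cost s + 1)
  | store (a : ℕ) (idx e : Expr) (s : State) :
      Exec (.store a idx e) s (s.setArr a (idx.eval s) (e.eval s)) (idx.cost s + e.cost s + 1)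
  | seq {c d : Cmd} {s s' s'' : State} {t u : ℕ} :
      Exec c s s' t → Exec d s' s'' u → Exec (.seq c d) s s'' (t + u)
  | cond_pos {e : Expr} {c d : Cmd} {s s' : State} {t : ℕ} :
      0 < e.eval s → Exec c s s' t → Exec (.cond e c d) s s' (e.cost s + t + 1)
  | cond_neg {e : Expr} {c d : Cmd} {s s' : State} {t : ℕ} :
      ¬ 0 < e.eval s → Exec d s s' t → Exec (.cond e c d) s s' (e.cost s + t + 1)
  | loop_done {e : Expr} {c : Cmd} {s : State} :
      ¬ 0 < e.eval s → Exec (.loop e c) s s (e.cost s + 1)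
  | loop_step {e : Expr} {c : Cmd} {s s' s'' : State} {t u : ℕ} :
      0 < e.eval s → Exec c s s' t → Exec (.loop e c) s' s'' u →
      Exec (.loop e c) s s'' (e.cost s + t + u + 1)

/-- Initial state on input `w`: register `0` holds the length of `w`, array `0` holds the words of
`w` from address `0` on, and everything else is zero. -/
def State.initial (w : List ℤ) : State where
  reg := fun r => if r = 0 then (w.length : ℤ) else 0
  arr := fun a k => if a = 0 ∧ 0 ≤ k then w.getD k.toNat 0 else 0

/-- The state presents the output `w`: register `0` holds the length of `w`, and array `1` holds
the words of `w` from address `0` on. -/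
def State.Outputs (s : State) (w : List ℤ) : Prop :=
  s.reg 0 = w.length ∧ ∀ k (h : k < w.length), s.arr 1 (k : ℤ) = w[k]

/-- Bit length of a list of words (at least one bit for each word). -/
def inputSize (w : List ℤ) : ℕ := (w.map fun z => bits z + 1).sum

end RAM

/-! ### Maximization problems and fully polynomial time approximation schemes -/

/-- A maximization problem together with the binary encoding of its instances and solutions.
`Represents I w x` says that the list of words `w` is a representation of the solution `x`. -/
structure MaxProblem where
  Inst : Type
  Sol : Inst → Type
  input : Inst → List ℤ
  Represents : (I : Inst) → List ℤ → Sol I → Prop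
  Feasible : (I : Inst) → Sol I → Prop
  objective : (I : Inst) → Sol I → ℝ

/-- A single program that, on every instance `I` and for every `ε > 0`, outputs a feasible solution
whose objective is at least `(1 - ε)` times that of every feasible solution, at a (logarithmic)
cost that is polynomial in the bit length of `I` and `1 / ε`. The accuracy is passed to the
program as the integer `⌈1 / ε⌉`, in front of the encoding of `I`. -/
def MaxProblem.HasFPTAS (P : MaxProblem) : Prop :=
  ∃ (prog : RAM.Cmd) (c d : ℕ), ∀ (I : P.Inst) (ε : ℝ), 0 < ε →
    ∃ (s : RAM.State) (t : ℕ) (w : List ℤ) (x : P.Sol I),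
      RAM.Exec prog (RAM.State.initial ((⌈1 / ε⌉₊ : ℤ) :: P.input I)) s t ∧
      (t : ℝ) ≤ c * ((RAM.inputSize (P.input I) : ℝ) + 1 / ε + 1) ^ d ∧
      s.Outputs w ∧ P.Represents I w x ∧
      P.Feasible I x ∧ ∀ y : P.Sol I, P.Feasible I y → (1 - ε) * P.objective I y ≤ P.objective I x

/-! ### Multi-unit markets with general valuations -/

/-- `n` buyers and `m` identical units. Buyer `i` has budget `budget i` and values `j` units of the
good at `value i j`, for `0 ≤ j ≤ m`; receiving nothing is not worth a negative amount. -/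
structure Market where
  n : ℕ
  m : ℕ
  budget : Fin n → ℚ
  value : Fin n → Fin (m + 1) → ℚ
  budget_pos : ∀ i, 0 < budget i
  value_zero_nonneg : ∀ i, 0 ≤ value i 0

namespace Market

/-- Utility of buyer `i` for `y` units at price `p` per unit; `⊥` stands for `-∞`. -/
noncomputable def utility (M : Market) (i : Fin M.n) (p : ℝ) (y : Fin (M.m + 1)) : WithBot ℝ :=
  if p * (y : ℕ) ≤ M.budget i then (((M.value i y : ℝ) - p * (y : ℕ) : ℝ) : WithBot ℝ) else ⊥

/-- The demand set: the affordable numbers of units of maximum utility. -/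
def demand (M : Market) (i : Fin M.n) (p : ℝ) : Set (Fin (M.m + 1)) :=
  {y | p * (y : ℕ) ≤ M.budget i ∧ ∀ z, M.utility i p z ≤ M.utility i p y}

/-- A price per unit and the number of units that each buyer receives. -/
structure Pricing (M : Market) where
  price : ℝ
  alloc : Fin M.n → Fin (M.m + 1)

/-- Envy-free pricings: at most `m` units are allocated, and every buyer receives an element of its
demand set. -/
def EnvyFree (M : Market) (q : M.Pricing) : Prop :=
  0 ≤ q.price ∧ ∑ i, (q.alloc i : ℕ) ≤ M.m ∧ ∀ i, q.alloc i ∈ M.demand i q.price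

/-- Social welfare. -/
noncomputable def welfare (M : Market) (q : M.Pricing) : ℝ := ∑ i, (M.value i (q.alloc i) : ℝ)

/-- Revenue. -/
noncomputable def revenue (M : Market) (q : M.Pricing) : ℝ := ∑ i, ((q.alloc i : ℕ) : ℝ) * q.price

/-- A rational number as two words. -/
def ratWords (r : ℚ) : List ℤ := [r.num, (r.den : ℤ)]

/-- Encoding of a market: `n`, `m`, and for every buyer its budget and all its values. -/
def encode (M : Market) : List ℤ :=
  (M.n : ℤ) :: (M.m : ℤ) ::
    (List.ofFn fun i : Fin M.n =>
      ratWords (M.budget i) ++ (List.ofFn fun j => ratWords (M.value i j)).flatten).flatten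

/-- A pricing is represented by the numerator and the (positive) denominator of its price, which
need not be in lowest terms, followed by the allocated numbers of units. -/
def Represents (M : Market) (w : List ℤ) (q : M.Pricing) : Prop :=
  ∃ a b : ℤ, 0 < b ∧ q.price = (a : ℝ) / (b : ℝ) ∧
    w = a :: b :: List.ofFn fun i => ((q.alloc i : ℕ) : ℤ)

end Market

/-- Computing a welfare-maximizing envy-free pricing. -/
noncomputable def welfareProblem : MaxProblem where
  Inst := Market
  Sol := Market.Pricing
  input := Market.encode
  Represents := Market.Represents
  Feasible := Market.EnvyFree
  objective := Market.welfare

/-- Computing a revenue-maximizing envy-free pricing. -/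
noncomputable def revenueProblem : MaxProblem where
  Inst := Market
  Sol := Market.Pricing
  input := Market.encode
  Represents := Market.Represents
  Feasible := Market.EnvyFree
  objective := Market.revenue

/-! ### Arithmetic notation for expressions and evaluation lemmas. -/

namespace RAM

/-! The optimum is computed exactly, and the accuracy word of the input is never read. As soon as
there is a buyer, the input lists at least `m + 1` values, so algorithms polynomial in `n` and `m`
are polynomial in the input length.

Prices. A buyer's demand can change only where two bundles tie, `(V y - V z) / (y - z)`, or where a
bundle stops being affordable, `B / y`. Take an envy-free pricing and raise its price to the next
such critical price: every bundle that was demanded is still demanded, so the same allocation has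
the same welfare and at least the same revenue. If no critical price lies at or above the given one,
nothing was sold, and the highest candidate price does as well. This is `exists_candidate`. It
therefore suffices to try polynomially many prices.

Allocations. At a fixed price each buyer may receive any bundle in its demand set, and choosing
bundles of total size at most `m` with maximal total gain is a knapsack with one choice per buyer.
The gain is the value for welfare and price times quantity for revenue. A table indexed by buyers
and available units solves it (`IsTable.sum_le`, `runs_extractCmd`).

Integers. All amounts are multiplied by the product of all denominators times `N!`, with `N` the
number of amounts. Budgets, values and critical prices then all become integers, because every
divisor `y - z` or `y` is at most `N` (`commonScale_eq`, `critical`). The scale has polynomially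
many bits (`abs_scale_le`).

Cost. `Runs R K` bounds the cost of a program by its syntactic `work R` times `K + 1`, where `R`
bounds the rounds of each loop and `K` the bits of all stored numbers. For a fixed program `work` is
polynomial in `R` (`Cmd.work_le_pow`), so only stored values and round counts remain to be bounded
(`bounds`, `time_le`). -/

instance : Add Expr := ⟨Expr.add⟩
instance : Sub Expr := ⟨Expr.sub⟩
instance : Mul Expr := ⟨Expr.mul⟩
instance : Div Expr := ⟨Expr.div⟩
instance (k : ℕ) : OfNat Expr k := ⟨Expr.const k⟩

@[simp] theorem Expr.eval_add (s : State) (e f : Expr) : (e + f).eval s = e.eval s + f.eval s := rfl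
@[simp] theorem Expr.eval_sub (s : State) (e f : Expr) : (e - f).eval s = e.eval s - f.eval s := rfl
@[simp] theorem Expr.eval_mul (s : State) (e f : Expr) : (e * f).eval s = e.eval s * f.eval s := rfl
@[simp] theorem Expr.eval_div (s : State) (e f : Expr) : (e / f).eval s = e.eval s / f.eval s := rfl
@[simp] theorem Expr.eval_reg (s : State) (r : ℕ) : (Expr.reg r).eval s = s.reg r := rfl
@[simp] theorem Expr.eval_const (s : State) (z : ℤ) : (Expr.const z).eval s = z := rfl
@[simp] theorem Expr.eval_ofNat (s : State) (k : ℕ) [k.AtLeastTwo] :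
    (ofNat(k) : Expr).eval s = (ofNat(k) : ℤ) := rfl
@[simp] theorem Expr.eval_zero (s : State) : (0 : Expr).eval s = 0 := rfl
@[simp] theorem Expr.eval_one (s : State) : (1 : Expr).eval s = 1 := rfl
@[simp] theorem Expr.eval_read (s : State) (a : ℕ) (e : Expr) :
    (Expr.read a e).eval s = s.arr a (e.eval s) := rfl

@[simp] theorem State.setReg_reg (s : State) (r q : ℕ) (z : ℤ) :
    (s.setReg r z).reg q = if q = r then z else s.reg q := by
  simp [State.setReg, Function.update_apply]
@[simp] theorem State.setReg_arr (s : State) (r : ℕ) (z : ℤ) : (s.setReg r z).arr = s.arr := rfl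
@[simp] theorem State.setArr_reg (s : State) (a : ℕ) (k z : ℤ) : (s.setArr a k z).reg = s.reg := rfl
@[simp] theorem State.setArr_arr (s : State) (a b : ℕ) (k j z : ℤ) :
    (s.setArr a k z).arr b j = if b = a ∧ j = k then z else s.arr b j := by
  simp only [State.setArr, Function.update_apply]
  split_ifs <;> simp_all

/-! ### Bit bounds and costs of expressions -/

theorem bits_le_iff {z : ℤ} {K : ℕ} : bits z ≤ K ↔ |z| < 2 ^ K := by
  rw [bits, Nat.size_le, Int.abs_eq_natAbs]
  exact_mod_cast Iff.rfl

/-- All registers and array cells have at most `K` bits. -/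
def Bdd (K : ℕ) (s : State) : Prop :=
  (∀ r, |s.reg r| < 2 ^ K) ∧ ∀ a k, |s.arr a k| < 2 ^ K

/-- Factor by which an expression can exceed the bit bound of the state. -/
def Expr.growth : Expr → ℕ
  | .const z => bits z
  | .reg _ => 1
  | .read _ _ => 1
  | .add e f => e.growth + f.growth + 1
  | .sub e f => e.growth + f.growth + 1
  | .mul e f => e.growth + f.growth
  | .div e _ => e.growth

/-- Factor by which the cost of an expression can exceed the bit bound of the state. -/
def Expr.weight : Expr → ℕ
  | .const z => bits z + 1
  | .reg _ => 2
  | .read _ e => e.weight + 2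
  | .add e f => e.weight + f.weight + (Expr.add e f).growth + 1
  | .sub e f => e.weight + f.weight + (Expr.sub e f).growth + 1
  | .mul e f => e.weight + f.weight + (Expr.mul e f).growth + 1
  | .div e f => e.weight + f.weight + (Expr.div e f).growth + 1

theorem bits_add_le {x y : ℤ} {a b : ℕ} (hx : bits x ≤ a) (hy : bits y ≤ b) :
    bits (x + y) ≤ a + b + 1 := by
  rw [bits_le_iff] at *
  have h1 : (2 : ℤ) ^ a ≤ 2 ^ (a + b) := pow_le_pow_right₀ (by norm_num) (by omega)
  have h2 : (2 : ℤ) ^ b ≤ 2 ^ (a + b) := pow_le_pow_right₀ (by norm_num) (by omega)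
  have := abs_add_le x y
  rw [pow_succ]
  linarith

theorem bits_neg (x : ℤ) : bits (-x) = bits x := by simp [bits]

theorem bits_mul_le {x y : ℤ} {a b : ℕ} (hx : bits x ≤ a) (hy : bits y ≤ b) :
    bits (x * y) ≤ a + b := by
  rw [bits_le_iff] at *
  rw [abs_mul, pow_add]
  exact mul_lt_mul'' hx hy (abs_nonneg _) (abs_nonneg _)

theorem bits_div_le (x y : ℤ) : bits (x / y) ≤ bits x :=
  Nat.size_le_size (Int.natAbs_ediv_le_natAbs x y)

/-- Intermediate results may exceed `K` bits, but only by a factor fixed by the syntax. Hence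
programs need explicit size bounds only for the values they store. -/
theorem Expr.bits_eval_le {K : ℕ} {s : State} (hs : Bdd K s) (e : Expr) :
    bits (e.eval s) ≤ e.growth * (K + 1) := by
  induction e with
  | const z => exact Nat.le_mul_of_pos_right _ (Nat.succ_pos K)
  | reg r => have := bits_le_iff.2 (hs.1 r); simp only [Expr.eval, Expr.growth]; omega
  | read a e _ =>
    have := bits_le_iff.2 (hs.2 a (e.eval s)); simp only [Expr.eval, Expr.growth]; omega
  | add e f he hf =>
    refine (bits_add_le he hf).trans ?_
    simp only [Expr.growth, add_mul]; omega
  | sub e f he hf =>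
    have := bits_add_le he (bits_neg (f.eval s) ▸ hf)
    rw [← sub_eq_add_neg] at this
    refine this.trans ?_
    simp only [Expr.growth, add_mul]; omega
  | mul e f he hf =>
    refine (bits_mul_le he hf).trans ?_
    simp only [Expr.growth, add_mul]; omega
  | div e f he hf => exact (bits_div_le _ _).trans he

theorem Expr.cost_le {K : ℕ} {s : State} (hs : Bdd K s) (e : Expr) :
    e.cost s ≤ e.weight * (K + 1) := by
  have key := fun e : Expr => e.bits_eval_le hs
  induction e with
  | const z => exact Nat.le_mul_of_pos_right _ (Nat.succ_pos K)
  | reg r => have := key (.reg r); simp only [Expr.eval, Expr.growth] at this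
             simp only [Expr.cost, Expr.weight]; omega
  | read a e he =>
    have := key (.read a e); simp only [Expr.growth] at this
    simp only [Expr.cost, Expr.weight, add_mul]; omega
  | add e f he hf => have := key (.add e f); simp only [Expr.cost, Expr.weight, add_mul] at *; omega
  | sub e f he hf => have := key (.sub e f); simp only [Expr.cost, Expr.weight, add_mul] at *; omega
  | mul e f he hf => have := key (.mul e f); simp only [Expr.cost, Expr.weight, add_mul] at *; omega
  | div e f he hf => have := key (.div e f); simp only [Expr.cost, Expr.weight, add_mul] at *; omega

/-! ### A program logic with costs -/

/-- Cost of a program, in multiples of the bit bound, when every loop runs at most `R` times. -/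
def Cmd.work (R : ℕ) : Cmd → ℕ
  | .skip => 1
  | .assign _ e => e.weight + 1
  | .store _ i e => i.weight + e.weight + 1
  | .seq c d => c.work R + d.work R
  | .cond e c d => e.weight + (c.work R + d.work R) + 1
  | .loop e c => R * (e.weight + c.work R + 1) + (e.weight + 1)

/-- Each loop multiplies the work of its body by about `R`, raising the degree by one. For sequences
and branches the sum of the two degrees is a crude common bound. -/
theorem Cmd.work_le_pow (c : Cmd) : ∃ a d : ℕ, ∀ R, c.work R ≤ a * (R + 1) ^ d := by
  induction c with
  | skip => exact ⟨1, 0, fun R => by simp [Cmd.work]⟩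
  | assign r e => exact ⟨e.weight + 1, 0, fun R => by simp [Cmd.work]⟩
  | store a i e => exact ⟨i.weight + e.weight + 1, 0, fun R => by simp [Cmd.work]⟩
  | seq c d hc hd =>
    obtain ⟨a, k, hc⟩ := hc
    obtain ⟨b, l, hd⟩ := hd
    refine ⟨a + b, k + l, fun R => ?_⟩
    have h1 : (R + 1) ^ k ≤ (R + 1) ^ (k + l) := Nat.pow_le_pow_right (by omega) (by omega)
    have h2 : (R + 1) ^ l ≤ (R + 1) ^ (k + l) := Nat.pow_le_pow_right (by omega) (by omega)
    have := (hc R).trans (Nat.mul_le_mul_left a h1)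
    have := (hd R).trans (Nat.mul_le_mul_left b h2)
    simp only [Cmd.work, add_mul]
    omega
  | cond e c d hc hd =>
    obtain ⟨a, k, hc⟩ := hc
    obtain ⟨b, l, hd⟩ := hd
    refine ⟨a + b + (e.weight + 1), k + l, fun R => ?_⟩
    have h1 : (R + 1) ^ k ≤ (R + 1) ^ (k + l) := Nat.pow_le_pow_right (by omega) (by omega)
    have h2 : (R + 1) ^ l ≤ (R + 1) ^ (k + l) := Nat.pow_le_pow_right (by omega) (by omega)
    have := (hc R).trans (Nat.mul_le_mul_left a h1)
    have := (hd R).trans (Nat.mul_le_mul_left b h2)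
    have : (e.weight + 1) * 1 ≤ (e.weight + 1) * (R + 1) ^ (k + l) :=
      Nat.mul_le_mul_left _ (Nat.one_le_pow _ _ (by omega))
    simp only [Cmd.work]
    rw [add_mul (a + b), add_mul a]
    omega
  | loop e c hc =>
    obtain ⟨a, k, hc⟩ := hc
    refine ⟨(e.weight + 1) + a, k + 1, fun R => ?_⟩
    have h1 : 1 ≤ (R + 1) ^ k := Nat.one_le_pow _ _ (by omega)
    have h2 := hc R
    have h3 : (e.weight + 1) * 1 ≤ (e.weight + 1) * (R + 1) ^ k := Nat.mul_le_mul_left _ h1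
    calc Cmd.work R (.loop e c) = R * (e.weight + c.work R + 1) + (e.weight + 1) := rfl
      _ ≤ R * (((e.weight + 1) + a) * (R + 1) ^ k) + ((e.weight + 1) + a) * (R + 1) ^ k := by
        gcongr
        · rw [add_mul]; omega
        · rw [add_mul]; omega
      _ = _ := by ring

/-- Whether a program may write a register. -/
def Cmd.setsReg (r : ℕ) : Cmd → Bool
  | .skip => false
  | .assign q _ => r == q
  | .store _ _ _ => false
  | .seq c d => c.setsReg r || d.setsReg r
  | .cond _ c d => c.setsReg r || d.setsReg r
  | .loop _ c => c.setsReg r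

/-- Whether a program may write an array. -/
def Cmd.setsArr (a : ℕ) : Cmd → Bool
  | .skip => false
  | .assign _ _ => false
  | .store b _ _ => a == b
  | .seq c d => c.setsArr a || d.setsArr a
  | .cond _ c d => c.setsArr a || d.setsArr a
  | .loop _ c => c.setsArr a

/-- `s'` agrees with `s` on everything that `c` does not write. -/
structure Frame (c : Cmd) (s s' : State) : Prop where
  reg : ∀ r, c.setsReg r = false → s'.reg r = s.reg r
  arr : ∀ a, c.setsArr a = false → s'.arr a = s.arr a

/-- The sets of written registers and arrays are computed from the syntax, so for concrete programs
the side conditions close by `rfl`. Invariants can then omit everything that a loop leaves alone. -/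
theorem Exec.frame {c : Cmd} {s s' : State} {t : ℕ} (h : Exec c s s' t) : Frame c s s' := by
  induction h with
  | skip s => exact ⟨fun _ _ => rfl, fun _ _ => rfl⟩
  | assign r e s =>
    refine ⟨fun q hq => ?_, fun _ _ => rfl⟩
    simp only [Cmd.setsReg, beq_eq_false_iff_ne] at hq
    simp [hq]
  | store a i e s =>
    refine ⟨fun _ _ => rfl, fun b hb => ?_⟩
    simp only [Cmd.setsArr, beq_eq_false_iff_ne] at hb
    funext j
    simp [hb]
  | seq _ _ h1 h2 =>
    refine ⟨fun r hr => ?_, fun a ha => ?_⟩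
    · simp only [Cmd.setsReg, Bool.or_eq_false_iff] at hr
      rw [h2.reg r hr.2, h1.reg r hr.1]
    · simp only [Cmd.setsArr, Bool.or_eq_false_iff] at ha
      rw [h2.arr a ha.2, h1.arr a ha.1]
  | cond_pos _ _ h | cond_neg _ _ h =>
    refine ⟨fun r hr => ?_, fun a ha => ?_⟩
    · simp only [Cmd.setsReg, Bool.or_eq_false_iff] at hr
      first | exact h.reg r hr.1 | exact h.reg r hr.2
    · simp only [Cmd.setsArr, Bool.or_eq_false_iff] at ha
      first | exact h.arr a ha.1 | exact h.arr a ha.2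
  | loop_done _ => exact ⟨fun _ _ => rfl, fun _ _ => rfl⟩
  | loop_step _ _ _ h1 h2 =>
    exact ⟨fun r hr => (h2.reg r hr).trans (h1.reg r hr),
      fun a ha => (h2.arr a ha).trans (h1.arr a ha)⟩

/-- From a state with `K`-bit contents, `c` halts in such a state with `Q`, at a cost that accounts
for at most `R` rounds of every loop. -/
def Runs (R K : ℕ) (c : Cmd) (s : State) (Q : State → Prop) : Prop :=
  Bdd K s → ∃ s' t, Exec c s s' t ∧ t ≤ c.work R * (K + 1) ∧ Bdd K s' ∧ Q s'

variable {R K : ℕ}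

theorem Runs.mono {c : Cmd} {s : State} {Q Q' : State → Prop} (h : Runs R K c s Q)
    (hQ : ∀ s', Frame c s s' → Q s' → Q' s') : Runs R K c s Q' := fun hs => by
  obtain ⟨s', t, he, ht, hb, hq⟩ := h hs
  exact ⟨s', t, he, ht, hb, hQ s' he.frame hq⟩

theorem Runs.skip {s : State} {Q : State → Prop} (h : Q s) : Runs R K .skip s Q := fun hs =>
  ⟨s, 1, .skip s, by simp [Cmd.work], hs, h⟩

theorem Runs.assign {r : ℕ} {e : Expr} {s : State} {Q : State → Prop}
    (hb : |e.eval s| < 2 ^ K) (h : Q (s.setReg r (e.eval s))) : Runs R K (.assign r e) s Q :=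
  fun hs => ⟨_, _, .assign r e s, by
    have := e.cost_le hs; simp only [Cmd.work, add_mul]; omega,
    ⟨fun q => by rw [State.setReg_reg]; split_ifs; exacts [hb, hs.1 q], hs.2⟩, h⟩

theorem Runs.store {a : ℕ} {i e : Expr} {s : State} {Q : State → Prop}
    (hb : |e.eval s| < 2 ^ K) (h : Q (s.setArr a (i.eval s) (e.eval s))) :
    Runs R K (.store a i e) s Q :=
  fun hs => ⟨_, _, .store a i e s, by
    have := e.cost_le hs; have := i.cost_le hs; simp only [Cmd.work, add_mul]; omega,
    ⟨hs.1, fun b j => by rw [State.setArr_arr]; split_ifs; exacts [hb, hs.2 b j]⟩, h⟩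

theorem Runs.seq {c d : Cmd} {s : State} {Q : State → Prop}
    (h : Runs R K c s fun s' => Runs R K d s' Q) : Runs R K (.seq c d) s Q := fun hs => by
  obtain ⟨s', t, he, ht, hb, hq⟩ := h hs
  obtain ⟨s'', u, he', hu, hb', hq'⟩ := hq hb
  exact ⟨s'', t + u, .seq he he', by simp only [Cmd.work, add_mul]; omega, hb', hq'⟩

theorem Runs.cond {e : Expr} {c d : Cmd} {s : State} {Q : State → Prop}
    (h1 : 0 < e.eval s → Runs R K c s Q) (h2 : ¬ 0 < e.eval s → Runs R K d s Q) :
    Runs R K (.cond e c d) s Q := fun hs => by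
  have hc := e.cost_le hs
  by_cases h : 0 < e.eval s
  · obtain ⟨s', t, he, ht, hb, hq⟩ := h1 h hs
    exact ⟨s', _, .cond_pos h he, by simp only [Cmd.work, add_mul]; omega, hb, hq⟩
  · obtain ⟨s', t, he, ht, hb, hq⟩ := h2 h hs
    exact ⟨s', _, .cond_neg h he, by simp only [Cmd.work, add_mul]; omega, hb, hq⟩

/-- A test without alternative. -/
abbrev Cmd.when (e : Expr) (c : Cmd) : Cmd := .cond e c .skip

theorem Runs.when {e : Expr} {c : Cmd} {s : State} {Q : State → Prop}
    (h1 : 0 < e.eval s → Runs R K c s Q) (h2 : e.eval s ≤ 0 → Q s) :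
    Runs R K (.when e c) s Q :=
  Runs.cond h1 fun h => Runs.skip (h2 (not_lt.1 h))

/-- The exact number `n` of rounds is known beforehand, so the proof is an induction on the number
of remaining rounds. The frame relative to the initial state is carried along and offered to every
step. -/
theorem Runs.loop {e : Expr} {c : Cmd} {s : State} {Q : State → Prop} (I : ℕ → State → Prop)
    (n : ℕ) (hn : n ≤ R) (h0 : I 0 s)
    (hstep : ∀ k s', k < n → Frame c s s' → I k s' → 0 < e.eval s' ∧ Runs R K c s' (I (k + 1)))
    (hend : ∀ s', Frame c s s' → I n s' → e.eval s' ≤ 0 ∧ Q s') :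
    Runs R K (.loop e c) s Q := by
  have key : ∀ j ≤ n, ∀ s', Frame c s s' → I (n - j) s' → Bdd K s' → ∃ s'' t,
      Exec (.loop e c) s' s'' t ∧ t ≤ (j * (e.weight + c.work R + 1) + (e.weight + 1)) * (K + 1) ∧
        Bdd K s'' ∧ Q s'' := by
    intro j
    induction j with
    | zero =>
      intro _ s' hf hi hb
      obtain ⟨h1, h2⟩ := hend s' hf hi
      have := e.cost_le hb
      exact ⟨s', _, .loop_done (not_lt.2 h1), by rw [zero_mul, zero_add, add_mul]; omega, hb, h2⟩
    | succ j ih =>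
      intro hj s' hf hi hb
      obtain ⟨h1, h2⟩ := hstep (n - (j + 1)) s' (by omega) hf hi
      obtain ⟨s'', t, he, ht, hb', hq⟩ := h2 hb
      have hf' := he.frame
      rw [show n - (j + 1) + 1 = n - j by omega] at hq
      obtain ⟨s₃, u, he', hu, hb₃, hq₃⟩ := ih (by omega) s''
        ⟨fun r hr => (hf'.reg r hr).trans (hf.reg r hr),
          fun a ha => (hf'.arr a ha).trans (hf.arr a ha)⟩ hq hb'
      have := e.cost_le hb
      refine ⟨s₃, _, .loop_step h1 he he', ?_, hb₃, hq₃⟩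
      calc e.cost s' + t + u + 1 ≤ e.weight * (K + 1) + c.work R * (K + 1) +
            (j * (e.weight + c.work R + 1) + (e.weight + 1)) * (K + 1) + (K + 1) := by omega
        _ = _ := by ring
  intro hs
  obtain ⟨s', t, he, ht, hb, hq⟩ := key n le_rfl s ⟨fun _ _ => rfl, fun _ _ => rfl⟩ (by simpa) hs
  exact ⟨s', t, he, ht.trans (by simp only [Cmd.work]; gcongr), hb, hq⟩

/-- `for r = 0, …, e - 1` do `c`. -/
abbrev Cmd.forTo (r : ℕ) (e : Expr) (c : Cmd) : Cmd :=
  .seq (.assign r 0) (.loop (e - .reg r) (.seq c (.assign r (.reg r + 1))))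

/-- The bound `e` is evaluated anew in each round, which is why `he` asks for its value in every
state that respects the frame. Since `hI` makes the invariant insensitive to the counter, the
increment preserves it. -/
theorem Runs.forTo {r : ℕ} {e : Expr} {c : Cmd} {s : State} {Q : State → Prop}
    (I : ℕ → State → Prop) (n : ℕ) (hn : n ≤ R) (hK : (n : ℤ) < 2 ^ K)
    (hr : c.setsReg r = false)
    (he : ∀ s', Frame (.forTo r e c) s s' → e.eval s' = n)
    (h0 : I 0 (s.setReg r 0))
    (hI : ∀ k s' z, I k s' → I k (s'.setReg r z))
    (hstep : ∀ k s', k < n → Frame (.forTo r e c) s s' → s'.reg r = k → I k s' →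
      Runs R K c s' (I (k + 1)))
    (hend : ∀ s', Frame (.forTo r e c) s s' → s'.reg r = n → I n s' → Q s') :
    Runs R K (.forTo r e c) s Q := by
  have hf0 : ∀ s', Frame (Cmd.seq c (.assign r (.reg r + 1))) (s.setReg r 0) s' →
      Frame (.forTo r e c) s s' := by
    intro s' h
    refine ⟨fun q hq => ?_, fun a ha => ?_⟩
    · simp only [Cmd.setsReg, Bool.or_eq_false_iff] at hq
      rw [h.reg q (by simp [Cmd.setsReg, hq])]
      have : q ≠ r := by simpa using hq.1
      simp [this]
    · simp only [Cmd.setsArr, Bool.or_eq_false_iff] at ha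
      rw [h.arr a (by simp [Cmd.setsArr, ha])]
      simp
  refine Runs.seq (Runs.assign (by simp) ?_)
  refine Runs.loop (fun k s' => s'.reg r = k ∧ I k s') n hn ⟨by simp, h0⟩ ?_ ?_
  · rintro k s' hk hf ⟨h1, h2⟩
    refine ⟨by simp [he s' (hf0 _ hf), h1, hk], Runs.seq ?_⟩
    refine (hstep k s' hk (hf0 _ hf) h1 h2).mono fun s'' hf' h3 => ?_
    have h4 : s''.reg r = k := (hf'.reg r hr).trans h1
    refine Runs.assign ?_ ⟨by simp [h4], hI _ _ _ h3⟩
    simp only [Expr.eval_add, Expr.eval_reg, h4, Expr.eval_one]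
    rw [abs_of_nonneg (by positivity)]
    have : ((k + 1 : ℕ) : ℤ) ≤ n := by exact_mod_cast hk
    push_cast at this
    linarith
  · rintro s' hf ⟨h1, h2⟩
    exact ⟨by simp [he s' (hf0 _ hf), h1], hend s' (hf0 _ hf) h1 h2⟩

end RAM

section
open Finset

/-! ### Envy-free pricings over the integers -/

/-- `y` units are in the demand, at price `P`, of a buyer with budget `B` and values `V`. -/
def Demanded (m : ℕ) (B : ℤ) (V : ℕ → ℤ) (P : ℤ) (y : ℕ) : Prop :=
  y ≤ m ∧ P * y ≤ B ∧ ∀ z ≤ m, P * z ≤ B → V z - P * z ≤ V y - P * y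

/-- The same for a real price. -/
def RealDemanded (m : ℕ) (B : ℤ) (V : ℕ → ℤ) (q : ℝ) (y : ℕ) : Prop :=
  y ≤ m ∧ q * y ≤ B ∧ ∀ z ≤ m, q * z ≤ B → V z - q * z ≤ V y - q * y

theorem realDemanded_intCast {m : ℕ} {B : ℤ} {V : ℕ → ℤ} {P : ℤ} {y : ℕ} :
    RealDemanded m B V P y ↔ Demanded m B V P y := by
  simp only [RealDemanded, Demanded]
  exact_mod_cast Iff.rfl

theorem Demanded.price_mul_le_value {m : ℕ} {B : ℤ} {V : ℕ → ℤ} {P : ℤ} {y : ℕ}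
    (h : Demanded m B V P y) (hB : 0 ≤ B) (hV : 0 ≤ V 0) : P * y ≤ V y := by
  have := h.2.2 0 (Nat.zero_le _) (by simpa)
  simp at this
  linarith

/-- The critical prices of a buyer are among the candidates `cand t`, `t < T`. -/
structure Critical (m : ℕ) (B : ℤ) (V : ℕ → ℤ) (T : ℕ) (cand : ℕ → ℤ) : Prop where
  value : ∀ y z, z < y → y ≤ m → ∃ t < T, cand t * (y - z) = V y - V z
  budget : ∀ y, 1 ≤ y → y ≤ m → ∃ t < T, cand t * y = B

/-- The price at which `z` units tie with none is a candidate, hence at most `P`. From there on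
buying nothing is at least as good. -/
theorem Critical.demanded_zero {m : ℕ} {B : ℤ} {V : ℕ → ℤ} {T : ℕ} {cand : ℕ → ℤ} {P : ℤ}
    (h : Critical m B V T cand) (hB : 0 ≤ B) (hP : ∀ t < T, cand t ≤ P) :
    Demanded m B V P 0 := by
  refine ⟨Nat.zero_le _, by simpa, fun z hz _ => ?_⟩
  rcases Nat.eq_zero_or_pos z with rfl | hz0
  · exact le_rfl
  · obtain ⟨t, ht, he⟩ := h.value z 0 hz0 hz
    have : cand t * z ≤ P * z := mul_le_mul_of_nonneg_right (hP t ht) (by positivity)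
    simp at he ⊢
    linarith

/-- Between `q` and the next candidate no bundle demanded at `q` becomes unaffordable or is
overtaken by another one. -/
theorem Critical.demanded_of_le {m : ℕ} {B : ℤ} {V : ℕ → ℤ} {T : ℕ} {cand : ℕ → ℤ} {P : ℤ} {q : ℝ}
    {y : ℕ} (h : Critical m B V T cand) (hB : 0 ≤ B) (hy : RealDemanded m B V q y) (hq : q ≤ P)
    (hP : ∀ t < T, q ≤ cand t → P ≤ cand t) : Demanded m B V P y := by
  rw [← realDemanded_intCast]
  obtain ⟨h1, h2, h3⟩ := hy
  refine ⟨h1, ?_, fun z hz hzB => ?_⟩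
  · rcases Nat.eq_zero_or_pos y with rfl | hy0
    · simpa using hB
    · obtain ⟨t, ht, he⟩ := h.budget y hy0 h1
      have hy0' : (0 : ℝ) < y := by exact_mod_cast hy0
      have he' : (cand t : ℝ) * y = B := by exact_mod_cast he
      have : q ≤ cand t := le_of_mul_le_mul_right (h2.trans he'.ge) hy0'
      rw [← he']
      exact mul_le_mul_of_nonneg_right (by exact_mod_cast hP t ht this) hy0'.le
  · have h4 := h3 z hz ((mul_le_mul_of_nonneg_right hq (Nat.cast_nonneg z)).trans hzB)
    -- A price increase hurts larger bundles more, so only smaller `z` could overtake `y`. The price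
    -- at which they tie is a candidate not below `q`, hence not below `P`.
    rcases le_or_gt y z with hyz | hyz
    · have : (y : ℝ) ≤ z := by exact_mod_cast hyz
      nlinarith
    · obtain ⟨t, ht, he⟩ := h.value y z hyz h1
      have hyz' : (0 : ℝ) < y - z := by rw [sub_pos]; exact_mod_cast hyz
      have he' : (cand t : ℝ) * (y - z) = V y - V z := by exact_mod_cast he
      have : q ≤ cand t := le_of_mul_le_mul_right (by linarith) hyz'
      have : (P : ℝ) ≤ cand t := by exact_mod_cast hP t ht this
      have := mul_le_mul_of_nonneg_right this hyz'.le
      linarith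

theorem Critical.eq_zero_of_lt {m : ℕ} {B : ℤ} {V : ℕ → ℤ} {T : ℕ} {cand : ℕ → ℤ} {q : ℝ} {y : ℕ}
    (h : Critical m B V T cand) (hy : RealDemanded m B V q y)
    (hP : ∀ t < T, (cand t : ℝ) < q) : y = 0 := by
  by_contra hy0
  obtain ⟨t, ht, he⟩ := h.budget y (by omega) hy.1
  have hy0' : (0 : ℝ) < y := by exact_mod_cast Nat.pos_of_ne_zero hy0
  have he' : (cand t : ℝ) * y = B := by exact_mod_cast he
  have := mul_lt_mul_of_pos_right (hP t ht) hy0'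
  linarith [hy.2.1]

/-- Some candidate price is at least as good as the real price `q`: it has the same demanded
allocation and it is not smaller, unless nothing is sold. -/
theorem exists_candidate {n m : ℕ} {B : ℕ → ℤ} {V : ℕ → ℕ → ℤ} {T : ℕ} {cand : ℕ → ℤ}
    (h : ∀ i < n, Critical m (B i) (V i) T cand) (hB : ∀ i < n, 0 ≤ B i)
    (h0 : ∃ t < T, 0 ≤ cand t) {q : ℝ} (hq : 0 ≤ q) {x : ℕ → ℕ}
    (hx : ∀ i < n, RealDemanded m (B i) (V i) q (x i)) :
    ∃ t < T, 0 ≤ cand t ∧ (∀ i < n, Demanded m (B i) (V i) (cand t) (x i)) ∧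
      (q ≤ cand t ∨ ∀ i < n, x i = 0) := by
  by_cases hne : ((range T).filter fun t => q ≤ cand t).Nonempty
  · obtain ⟨t, ht, hmin⟩ := exists_min_image _ cand hne
    simp only [mem_filter, mem_range, and_imp] at ht hmin
    exact ⟨t, ht.1, by exact_mod_cast hq.trans ht.2,
      fun i hi => (h i hi).demanded_of_le (hB i hi) (hx i hi) ht.2 hmin, .inl ht.2⟩
  · simp only [not_nonempty_iff_eq_empty, filter_eq_empty_iff, mem_range, not_le] at hne
    obtain ⟨t₀, ht₀, h0⟩ := h0
    obtain ⟨t, ht, hmax⟩ := exists_max_image (range T) cand ⟨t₀, mem_range.2 ht₀⟩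
    simp only [mem_range] at ht hmax
    have hz : ∀ i < n, x i = 0 := fun i hi => (h i hi).eq_zero_of_lt (hx i hi) fun t ht => hne ht
    exact ⟨t, ht, h0.trans (hmax _ ht₀),
      fun i hi => hz i hi ▸ (h i hi).demanded_zero (hB i hi) hmax, .inr hz⟩

/-- Some candidate price is envy-free when nothing is sold. -/
theorem exists_candidate_zero {n m : ℕ} {B : ℕ → ℤ} {V : ℕ → ℕ → ℤ} {T : ℕ} {cand : ℕ → ℤ}
    (h : ∀ i < n, Critical m (B i) (V i) T cand) (hB : ∀ i < n, 0 ≤ B i)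
    (h0 : ∃ t < T, 0 ≤ cand t) :
    ∃ t < T, 0 ≤ cand t ∧ ∀ i < n, Demanded m (B i) (V i) (cand t) 0 := by
  obtain ⟨t₀, ht₀, h0⟩ := h0
  obtain ⟨t, ht, hmax⟩ := exists_max_image (range T) cand ⟨t₀, mem_range.2 ht₀⟩
  simp only [mem_range] at ht hmax
  exact ⟨t, ht, h0.trans (hmax _ ht₀), fun i hi => (h i hi).demanded_zero (hB i hi) hmax⟩

/-! ### The dynamic program -/

/-- The recurrence of the dynamic program for the first `i + 1` buyers and at most `c` units. The
best total gain is `f (i + 1) c`, or `-1` if there is none, and the last of the buyers receives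
`ch (i + 1) c` units for it. `D i y` says that buyer `i` may receive `y` units, and `g i y` is the
gain from that. -/
structure IsCell (D : ℕ → ℕ → Prop) (g : ℕ → ℕ → ℤ) (f ch : ℕ → ℕ → ℤ) (i c : ℕ) : Prop where
  upper : ∀ y ≤ c, D i y → 0 ≤ f i (c - y) → f i (c - y) + g i y ≤ f (i + 1) c
  attained : f (i + 1) c = -1 ∨ ∃ y ≤ c, ch (i + 1) c = y ∧ D i y ∧
    0 ≤ f i (c - y) ∧ f (i + 1) c = f i (c - y) + g i y

/-- The table of the dynamic program for `n` buyers and at most `m` units. -/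
structure IsTable (D : ℕ → ℕ → Prop) (g : ℕ → ℕ → ℤ) (n m : ℕ) (f ch : ℕ → ℕ → ℤ) : Prop where
  zero : ∀ c ≤ m, f 0 c = 0
  cell : ∀ i < n, ∀ c ≤ m, IsCell D g f ch i c

variable {D : ℕ → ℕ → Prop} {g : ℕ → ℕ → ℤ} {n m : ℕ} {f ch : ℕ → ℕ → ℤ}

theorem IsCell.congr {f' ch' : ℕ → ℕ → ℤ} {i c : ℕ} (h : IsCell D g f ch i c)
    (hf : ∀ c' ≤ c, f' i c' = f i c') (hf' : f' (i + 1) c = f (i + 1) c)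
    (hch : ch' (i + 1) c = ch (i + 1) c) : IsCell D g f' ch' i c := by
  refine ⟨fun y hy => ?_, ?_⟩
  · rw [hf _ (Nat.sub_le _ _), hf']
    exact h.upper y hy
  · rw [hf', hch]
    refine h.attained.imp_right ?_
    rintro ⟨y, hy, h1⟩
    exact ⟨y, hy, by rwa [hf _ (Nat.sub_le _ _)]⟩

theorem IsTable.congr {f' ch' : ℕ → ℕ → ℤ} (h : IsTable D g n m f ch)
    (hf : ∀ i ≤ n, ∀ c ≤ m, f' i c = f i c) (hch : ∀ i ≤ n, ∀ c ≤ m, ch' i c = ch i c) :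
    IsTable D g n m f' ch' :=
  ⟨fun c hc => (hf 0 (Nat.zero_le _) c hc).trans (h.zero c hc), fun i hi c hc =>
    (h.cell i hi c hc).congr (fun c' hc' => hf i hi.le c' (hc'.trans hc)) (hf _ hi c hc)
      (hch _ hi c hc)⟩

/-- Nonnegative gains are essential: they show that the entry reached by a feasible prefix is not
the sentinel `-1`, so the recurrence may be applied to it. -/
theorem IsTable.sum_le (h : IsTable D g n m f ch) (hg : ∀ i < n, ∀ y, D i y → 0 ≤ g i y)
    (x : ℕ → ℕ) : ∀ i ≤ n, ∀ c ≤ m, (∀ j < i, D j (x j)) → ∑ j ∈ range i, x j ≤ c →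
      ∑ j ∈ range i, g j (x j) ≤ f i c := by
  intro i
  induction i with
  | zero => intro _ c hc _ _; simp [h.zero c hc]
  | succ i ih =>
    intro hi c hc hx hs
    rw [sum_range_succ] at hs ⊢
    have h1 := ih (by omega) (c - x i) (by omega) (fun j hj => hx j (by omega)) (by omega)
    have h0 : 0 ≤ ∑ j ∈ range i, g j (x j) := sum_nonneg fun j hj => by
      have := mem_range.1 hj
      exact hg j (by omega) _ (hx j (by omega))
    have h2 := (h.cell i hi c hc).upper (x i) (by omega) (hx i (by omega)) (h0.trans h1)
    linarith

theorem IsTable.bounds (h : IsTable D g n m f ch) {G : ℤ} (hg : ∀ i < n, ∀ y, D i y → 0 ≤ g i y)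
    (hG : ∀ i < n, ∀ y, D i y → g i y ≤ G) (hG0 : 0 ≤ G) :
    ∀ i ≤ n, ∀ c ≤ m, -1 ≤ f i c ∧ f i c ≤ i * G := by
  intro i
  induction i with
  | zero => intro _ c hc; simp [h.zero c hc]
  | succ i ih =>
    intro hi c hc
    have : 0 ≤ (i + 1) * G := by positivity
    push_cast
    rcases (h.cell i hi c hc).attained with he | ⟨y, hy, -, hD, h0, he⟩
    · rw [he]; exact ⟨le_rfl, by linarith⟩
    · have := ih (by omega) (c - y) (by omega)
      have := hg i hi y hD
      have := hG i hi y hD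
      exact ⟨by linarith, by linarith⟩

end

namespace RAM
open Finset

/-! ### The program

Registers: 1, 2 hold `n`, `m`; 3 the common scale of all amounts; 4 the number of amounts; 5 is the
index of the candidate price and 8 that price; 9 is the buyer and 10 its utility; 11 a number of
units; 12 a number of available units; 13, 14 gain and choice of a cell of the table; 15 the best
objective. Array 2 is the table of the dynamic program and array 3 the choices. -/

/-- The amount with index `k`, scaled by `L`. -/
def entry (a : ℤ → ℤ) (L : ℤ) (k : ℕ) : ℤ := a (2 * k + 3) * (L / a (2 * k + 4))

def budgetAt (a : ℤ → ℤ) (m : ℕ) (L : ℤ) (i : ℕ) : ℤ := entry a L (i * (m + 2))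

def valueAt (a : ℤ → ℤ) (m : ℕ) (L : ℤ) (i y : ℕ) : ℤ := entry a L (i * (m + 2) + 1 + y)

def entryE (e : Expr) : Expr := .read 0 (2 * e + 3) * (.reg 3 / .read 0 (2 * e + 4))

def budgetE : Expr := entryE (.reg 9 * (.reg 2 + 2))

def valueE (e : Expr) : Expr := entryE (.reg 9 * (.reg 2 + 2) + 1 + e)

/-- The search for the best affordable utility starts from zero units, which every budget allows. As
tests ask for positivity, a comparison `x ≤ y` of integers is written `0 < y + 1 - x`. -/
def utilityCmd : Cmd :=
  .seq (.assign 10 (valueE 0)) <|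
  .forTo 11 (.reg 2 + 1) <|
    .when (budgetE + 1 - .reg 8 * .reg 11) <|
    .when (valueE (.reg 11) - .reg 8 * .reg 11 - .reg 10) <|
    .assign 10 (valueE (.reg 11) - .reg 8 * .reg 11)

def restE : Expr := .read 2 (.reg 9 * (.reg 2 + 1) + (.reg 12 - .reg 11))

def cellIndexE : Expr := (.reg 9 + 1) * (.reg 2 + 1) + .reg 12

/-- The four nested tests ask in turn whether the bundle is affordable, of maximal utility,
compatible with a feasible choice for the earlier buyers, and an improvement. -/
def cellCmd (gain : Expr) : Cmd :=
  .seq (.assign 13 (.const (-1))) <|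
  .seq (.assign 14 0) <|
  .seq
    (.forTo 11 (.reg 12 + 1) <|
      .when (budgetE + 1 - .reg 8 * .reg 11) <|
      .when (valueE (.reg 11) - .reg 8 * .reg 11 + 1 - .reg 10) <|
      .when (restE + 1) <|
      .when (restE + gain - .reg 13) <|
      .seq (.assign 13 (restE + gain)) (.assign 14 (.reg 11))) <|
  .seq (.store 2 cellIndexE (.reg 13)) (.store 3 cellIndexE (.reg 14))

def rowCmd (gain : Expr) : Cmd :=
  .seq utilityCmd <| .forTo 12 (.reg 2 + 1) (cellCmd gain)

def tableCmd (gain : Expr) : Cmd := .forTo 9 (.reg 1) (rowCmd gain)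

/-- The choices are traced back from the last buyer. In round `k` the buyer is `n - 1 - k`, whose
bundle goes to address `2 + (n - 1 - k)`, after the two words of the price. -/
def extractCmd : Cmd :=
  .seq (.assign 12 (.reg 2)) <|
  .forTo 9 (.reg 1) <|
    .seq (.assign 11 (.read 3 ((.reg 1 - .reg 9) * (.reg 2 + 1) + .reg 12))) <|
    .seq (.store 1 (1 + .reg 1 - .reg 9) (.reg 11)) (.assign 12 (.reg 12 - .reg 11))

def lastE : Expr := .read 2 (.reg 1 * (.reg 2 + 1) + .reg 2)

def tryCmd (gain : Expr) : Cmd :=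
  .seq (tableCmd gain) <|
  .when (lastE - .reg 15) <|
  .seq (.assign 15 lastE) <|
  .seq (.store 1 0 (.reg 8)) <|
  .seq (.store 1 1 (.reg 3)) extractCmd

/-- The candidate price with index `t`: with `k₁ = t / ((N + 1) (m + 1))`,
`k₂ = t / (m + 1) mod (N + 1)` and `d = t mod (m + 1)` it is `(entry k₁ - entry k₂) / d`. -/
def candidate (a : ℤ → ℤ) (N m : ℕ) (L : ℤ) (t : ℕ) : ℤ :=
  (entry a L (t / (m + 1) / (N + 1)) - entry a L (t / (m + 1) % (N + 1))) / (t % (m + 1) : ℕ)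

def modE (e f : Expr) : Expr := e - e / f * f

def candidateE : Expr :=
  (entryE (.reg 5 / (.reg 2 + 1) / (.reg 4 + 1)) -
    entryE (modE (.reg 5 / (.reg 2 + 1)) (.reg 4 + 1))) / modE (.reg 5) (.reg 2 + 1)

def scaleCmd : Cmd :=
  .seq (.assign 3 1) <|
  .forTo 5 (.reg 4) (.assign 3 (.reg 3 * (.read 0 (2 * .reg 5 + 4) * (.reg 5 + 1))))

def searchCmd (gain : Expr) : Cmd :=
  .seq (.assign 15 (.const (-1))) <|
  .forTo 5 ((.reg 4 + 1) * (.reg 4 + 1) * (.reg 2 + 1)) <|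
    .seq (.assign 8 candidateE) <| .when (.reg 8 + 1) (tryCmd gain)

/-- Without buyers the input lists no values and `m` may be exponential in its length, so a loop
over the units is not allowed. That case outputs the price `0 / 1` at once. -/
def mainCmd (gain : Expr) : Cmd :=
  .seq (.assign 1 (.read 0 1)) <|
  .seq (.assign 2 (.read 0 2)) <|
  .cond (.reg 1)
    (.seq (.assign 4 (.reg 1 * (.reg 2 + 2))) <|
      .seq scaleCmd <| .seq (searchCmd gain) (.assign 0 (.reg 1 + 2)))
    (.seq (.store 1 1 1) (.assign 0 2))

/-! ### Correctness -/

/-- The state in which the main part of the program works. -/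
structure Env (a : ℤ → ℤ) (n m : ℕ) (L : ℤ) (s : State) : Prop where
  r1 : s.reg 1 = n
  r2 : s.reg 2 = m
  r3 : s.reg 3 = L
  r4 : s.reg 4 = (n * (m + 2) : ℕ)
  a0 : s.arr 0 = a

variable {a : ℤ → ℤ} {n m : ℕ} {L : ℤ} {s s' : State} {R K : ℕ} {H : ℤ}

theorem Env.of_frame (h : Env a n m L s) {c : Cmd} (hf : Frame c s s')
    (h1 : c.setsReg 1 = false) (h2 : c.setsReg 2 = false) (h3 : c.setsReg 3 = false)
    (h4 : c.setsReg 4 = false) (h0 : c.setsArr 0 = false) : Env a n m L s' :=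
  ⟨(hf.reg 1 h1).trans h.r1, (hf.reg 2 h2).trans h.r2, (hf.reg 3 h3).trans h.r3,
    (hf.reg 4 h4).trans h.r4, (hf.arr 0 h0).trans h.a0⟩

theorem Env.eval_entryE (h : Env a n m L s) {e : Expr} {k : ℕ} (he : e.eval s = k) :
    (entryE e).eval s = entry a L k := by
  simp [entryE, entry, he, h.r3, h.a0]

theorem Env.eval_budgetE (h : Env a n m L s) {i : ℕ} (hi : s.reg 9 = i) :
    budgetE.eval s = budgetAt a m L i :=
  h.eval_entryE (by simp [hi, h.r2])

theorem Env.eval_valueE (h : Env a n m L s) {i y : ℕ} {e : Expr} (hi : s.reg 9 = i)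
    (he : e.eval s = y) : (valueE e).eval s = valueAt a m L i y :=
  h.eval_entryE (by simp [hi, h.r2, he])

/-- Bounds on all the amounts and numbers of rounds. -/
structure Bounds (a : ℤ → ℤ) (n m : ℕ) (L H : ℤ) (R K : ℕ) : Prop where
  entry_le : ∀ k ≤ n * (m + 2), |entry a L k| ≤ H
  rounds : (n * (m + 2) + 1) * (n * (m + 2) + 1) * (m + 1) ≤ R
  bits : ((R : ℤ) + 3) * (H + 1) < 2 ^ K
  budget_nonneg : ∀ i < n, 0 ≤ budgetAt a m L i
  value_nonneg : ∀ i < n, 0 ≤ valueAt a m L i 0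

theorem Bounds.H_nonneg (h : Bounds a n m L H R K) : 0 ≤ H :=
  (abs_nonneg _).trans (h.entry_le 0 (Nat.zero_le _))

theorem Bounds.R_lt (h : Bounds a n m L H R K) : (R : ℤ) + 2 < 2 ^ K := by
  have := h.bits
  have := h.H_nonneg
  nlinarith

theorem Bounds.lt_of_le (h : Bounds a n m L H R K) {z : ℤ} (hz : |z| ≤ 2 * H) : |z| < 2 ^ K := by
  have := h.bits
  have := h.H_nonneg
  nlinarith

theorem Bounds.m_lt (h : Bounds a n m L H R K) : m + 1 ≤ R :=
  le_trans (Nat.le_mul_of_pos_left _ (by positivity)) h.rounds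

theorem Bounds.n_le (h : Bounds a n m L H R K) : n ≤ R := by
  refine le_trans ?_ h.rounds
  rw [mul_assoc]
  refine le_trans ?_ (Nat.le_mul_of_pos_right _ (by positivity))
  nlinarith

theorem Bounds.lt_of_nat (h : Bounds a n m L H R K) {k : ℕ} (hk : k ≤ R) : (k : ℤ) < 2 ^ K := by
  have := h.R_lt
  have : (k : ℤ) ≤ R := by exact_mod_cast hk
  linarith

theorem Bounds.abs_budget_le (h : Bounds a n m L H R K) {i : ℕ} (hi : i < n) :
    |budgetAt a m L i| ≤ H := h.entry_le _ (by gcongr)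

theorem Bounds.abs_value_le (h : Bounds a n m L H R K) {i y : ℕ} (hi : i < n) (hy : y ≤ m) :
    |valueAt a m L i y| ≤ H := h.entry_le _ (by
  calc i * (m + 2) + 1 + y ≤ (i + 1) * (m + 2) := by rw [add_mul]; omega
    _ ≤ _ := by gcongr; omega)

/-- Demand in the scaled market. -/
abbrev DemandedAt (a : ℤ → ℤ) (m : ℕ) (L P : ℤ) (i y : ℕ) : Prop :=
  Demanded m (budgetAt a m L i) (valueAt a m L i) P y

/-- Affordability keeps the payment below the budget, whatever the size of the price. -/
theorem Bounds.abs_utility_le (h : Bounds a n m L H R K) {i y : ℕ} {P : ℤ} (hi : i < n)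
    (hy : y ≤ m) (hP : 0 ≤ P) (hB : P * y ≤ budgetAt a m L i) :
    |valueAt a m L i y - P * y| ≤ 2 * H := by
  have h1 := h.abs_value_le hi hy
  have h2 := (abs_le.1 (h.abs_budget_le hi)).2
  have h3 : 0 ≤ P * y := by positivity
  rw [abs_le] at *
  constructor <;> linarith

/-- Register 10 ends as the maximal utility, recorded only through its use: membership in the demand
set becomes two comparisons. -/
theorem runs_utilityCmd (hE : Env a n m L s) (hb : Bounds a n m L H R K) {i : ℕ} {P : ℤ}
    (hi : s.reg 9 = i) (hin : i < n) (hP : s.reg 8 = P) (hP0 : 0 ≤ P) :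
    Runs R K utilityCmd s fun s' => ∀ y, DemandedAt a m L P i y ↔
      y ≤ m ∧ P * y ≤ budgetAt a m L i ∧ s'.reg 10 ≤ valueAt a m L i y - P * y := by
  have hv : (valueE 0).eval s = valueAt a m L i 0 := hE.eval_valueE hi rfl
  refine Runs.seq (Runs.assign ?_ ?_)
  · rw [hv]
    exact hb.lt_of_le ((hb.abs_value_le hin (Nat.zero_le _)).trans (by linarith [hb.H_nonneg]))
  rw [hv]
  have hE1 : Env a n m L (s.setReg 10 (valueAt a m L i 0)) := ⟨by simp [hE.r1], by simp [hE.r2],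
    by simp [hE.r3], by simp [hE.r4], by simp [hE.a0]⟩
  refine Runs.forTo (fun k s' => (∀ y < k, P * y ≤ budgetAt a m L i →
      valueAt a m L i y - P * y ≤ s'.reg 10) ∧ ∃ y ≤ m, P * y ≤ budgetAt a m L i ∧
        s'.reg 10 = valueAt a m L i y - P * y) (m + 1) hb.m_lt (hb.lt_of_nat hb.m_lt)
    rfl ?_ ?_ ?_ ?_ ?_
  · intro s' hf
    simp [(hE1.of_frame hf rfl rfl rfl rfl rfl).r2]
  · refine ⟨fun y hy => absurd hy (Nat.not_lt_zero _), 0, Nat.zero_le _, ?_, by simp⟩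
    simpa using hb.budget_nonneg i hin
  · intro k s' z h
    simpa using h
  · intro k s' hk hf hr hI
    have hE2 := hE1.of_frame hf rfl rfl rfl rfl rfl
    have h9 : s'.reg 9 = i := (hf.reg 9 rfl).trans (by simp [hi])
    have h8 : s'.reg 8 = P := (hf.reg 8 rfl).trans (by simp [hP])
    have hv : (valueE (.reg 11)).eval s' = valueAt a m L i k := hE2.eval_valueE h9 hr
    have hB : budgetE.eval s' = budgetAt a m L i := hE2.eval_budgetE h9
    obtain ⟨h1, h2⟩ := hI
    refine Runs.when (fun hc => ?_) fun hc => ?_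
    · simp only [Expr.eval_add, Expr.eval_sub, Expr.eval_mul, Expr.eval_reg, Expr.eval_one, hB, h8,
        hr] at hc
      refine Runs.when (fun hc' => Runs.assign ?_ ?_) fun hc' => ?_
      · simp only [Expr.eval_sub, Expr.eval_mul, Expr.eval_reg, hv, h8, hr]
        exact hb.lt_of_le (hb.abs_utility_le hin (by omega) hP0 (by linarith))
      · simp only [Expr.eval_sub, Expr.eval_mul, Expr.eval_reg, hv, h8, hr] at hc' ⊢
        refine ⟨fun y hy hyB => ?_, k, by omega, by linarith, by simp⟩
        rcases Nat.lt_succ_iff_lt_or_eq.1 hy with hy | rfl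
        · simp only [State.setReg_reg, if_true]
          linarith [h1 y hy hyB]
        · simp
      · simp only [Expr.eval_sub, Expr.eval_mul, Expr.eval_reg, hv, h8, hr] at hc' 
        refine ⟨fun y hy hyB => ?_, h2⟩
        rcases Nat.lt_succ_iff_lt_or_eq.1 hy with hy | rfl
        · exact h1 y hy hyB
        · linarith
    · simp only [Expr.eval_add, Expr.eval_sub, Expr.eval_mul, Expr.eval_reg, Expr.eval_one, hB, h8,
        hr] at hc
      refine ⟨fun y hy hyB => ?_, h2⟩
      rcases Nat.lt_succ_iff_lt_or_eq.1 hy with hy | rfl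
      · exact h1 y hy hyB
      · linarith
  · rintro s' hf - ⟨h1, y₀, hy₀, hB₀, h2⟩ y
    constructor
    · rintro ⟨h3, h4, h5⟩
      exact ⟨h3, h4, h2 ▸ h5 y₀ hy₀ hB₀⟩
    · rintro ⟨h3, h4, h5⟩
      exact ⟨h3, h4, fun z hz hzB => (h1 z (by omega) hzB).trans h5⟩

end RAM

/-! ### Correctness of the dynamic program and of the traceback. -/

namespace RAM
open Finset
variable {a : ℤ → ℤ} {n m : ℕ} {L : ℤ} {s s' : State} {R K : ℕ} {H : ℤ}

/-- Row `i`, column `c` of a table with columns `0, …, m` that is stored row by row. -/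
def tab (m : ℕ) (A : ℤ → ℤ) (i c : ℕ) : ℤ := A (i * (m + 1) + c)

theorem cell_index_inj {m i j c d : ℕ} (hc : c ≤ m) (hd : d ≤ m)
    (h : (i : ℤ) * (m + 1) + c = j * (m + 1) + d) : i = j ∧ c = d := by
  have h : c + (m + 1) * i = d + (m + 1) * j := by zify; linarith
  have h1 := congrArg (· / (m + 1)) h
  have h2 := congrArg (· % (m + 1)) h
  simp only [Nat.add_mul_div_left _ _ (Nat.succ_pos m), Nat.add_mul_mod_self_left,
    Nat.div_eq_of_lt (Nat.lt_succ_of_le hc), Nat.div_eq_of_lt (Nat.lt_succ_of_le hd),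
    Nat.mod_eq_of_lt (Nat.lt_succ_of_le hc), Nat.mod_eq_of_lt (Nat.lt_succ_of_le hd)] at h1 h2
  omega

/-- The expression `gain` evaluates the gain `g P i y` from selling `y` units to buyer `i` at the
price `P`. -/
structure GainSpec (gain : Expr) (g : ℤ → ℕ → ℕ → ℤ) (a : ℤ → ℤ) (n m : ℕ) (L H : ℤ) : Prop where
  eval : ∀ s P i y, Env a n m L s → s.reg 8 = P → s.reg 9 = (i : ℕ) → s.reg 11 = (y : ℕ) →
    gain.eval s = g P i y
  nonneg : ∀ P i y, 0 ≤ P → i < n → DemandedAt a m L P i y → 0 ≤ g P i y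
  le : ∀ P i y, 0 ≤ P → i < n → DemandedAt a m L P i y → g P i y ≤ H

variable {gain : Expr} {g : ℤ → ℕ → ℕ → ℤ}

theorem Bounds.lt_of_table (hb : Bounds a n m L H R K) (hG : GainSpec gain g a n m L H) {i : ℕ}
    {P : ℤ} (hin : i ≤ n) (hP0 : 0 ≤ P) {f ch : ℕ → ℕ → ℤ}
    (hT : IsTable (DemandedAt a m L P) (g P) i m f ch) {c : ℕ} (hc : c ≤ m) :
    |f i c| + H < 2 ^ K := by
  have h1 := hT.bounds (fun j hj y hD => hG.nonneg P j y hP0 (by omega) hD)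
    (fun j hj y hD => hG.le P j y hP0 (by omega) hD) hb.H_nonneg i le_rfl c hc
  have hH := hb.H_nonneg
  have h2 : (i : ℤ) ≤ R := by exact_mod_cast hin.trans hb.n_le
  have h3 : (i : ℤ) * H ≤ R * H := mul_le_mul_of_nonneg_right h2 hH
  have := hb.bits
  have h4 : |f i c| ≤ R * H + 1 :=
    abs_le.2 ⟨by nlinarith [mul_nonneg (Int.natCast_nonneg R) hH], by linarith⟩
  nlinarith

/-- Row `i + 1` depends only on row `i`, so besides the recurrence for the new cell it must be known
that no other cell changes. `cell_index_inj` supplies this for the row-by-row layout. -/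
theorem runs_cellCmd (hE : Env a n m L s) (hb : Bounds a n m L H R K)
    (hG : GainSpec gain g a n m L H) {i c : ℕ} {P : ℤ}
    (hi : s.reg 9 = i) (hin : i < n) (hP : s.reg 8 = P) (hP0 : 0 ≤ P)
    (hU : ∀ y, DemandedAt a m L P i y ↔
      y ≤ m ∧ P * y ≤ budgetAt a m L i ∧ s.reg 10 ≤ valueAt a m L i y - P * y)
    (hT : IsTable (DemandedAt a m L P) (g P) i m (tab m (s.arr 2)) (tab m (s.arr 3)))
    (hc : s.reg 12 = c) (hcm : c ≤ m) :
    Runs R K (cellCmd gain) s fun s' =>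
      IsCell (DemandedAt a m L P) (g P) (tab m (s'.arr 2)) (tab m (s'.arr 3)) i c ∧
      ∀ j, ∀ d ≤ m, (j = i + 1 → d ≠ c) → tab m (s'.arr 2) j d = tab m (s.arr 2) j d ∧
        tab m (s'.arr 3) j d = tab m (s.arr 3) j d := by
  set f := tab m (s.arr 2) with hf
  have hR1 := hb.R_lt
  have hcR : c + 1 ≤ R := (Nat.succ_le_succ hcm).trans hb.m_lt
  refine Runs.seq (Runs.assign (by simp; linarith) (Runs.seq (Runs.assign (by simp) ?_)))
  simp only [Expr.eval_const, Expr.eval_zero]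
  set s₁ := (s.setReg 13 (-1)).setReg 14 0 with hs₁
  have hE1 : Env a n m L s₁ := ⟨by simp [hs₁, hE.r1], by simp [hs₁, hE.r2], by simp [hs₁, hE.r3],
    by simp [hs₁, hE.r4], by simp [hs₁, hE.a0]⟩
  refine Runs.seq ?_
  refine Runs.forTo (fun k s' =>
    (∀ y < k, DemandedAt a m L P i y → 0 ≤ f i (c - y) → f i (c - y) + g P i y ≤ s'.reg 13) ∧
    -1 ≤ s'.reg 13 ∧
    (s'.reg 13 = -1 ∨ ∃ y ≤ c, s'.reg 14 = y ∧ DemandedAt a m L P i y ∧ 0 ≤ f i (c - y) ∧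
      s'.reg 13 = f i (c - y) + g P i y)) (c + 1) hcR (hb.lt_of_nat hcR) rfl ?_ ?_ ?_ ?_ ?_
  · intro s' h
    simp [(h.reg 12 rfl).trans (show s₁.reg 12 = c by simp [hs₁, hc])]
  · simp [hs₁]
  · intro k s' z h
    simpa using h
  · intro k s' hk hfr hr hI
    have hkm : k ≤ m := by omega
    have hE2 := hE1.of_frame hfr rfl rfl rfl rfl rfl
    have h9 : s'.reg 9 = i := (hfr.reg 9 rfl).trans (by simp [hs₁, hi])
    have h8 : s'.reg 8 = P := (hfr.reg 8 rfl).trans (by simp [hs₁, hP])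
    have h12 : s'.reg 12 = c := (hfr.reg 12 rfl).trans (by simp [hs₁, hc])
    have h10 : s'.reg 10 = s.reg 10 := (hfr.reg 10 rfl).trans (by simp [hs₁])
    have ha2 : s'.arr 2 = s.arr 2 := (hfr.arr 2 rfl).trans (by simp [hs₁])
    have hv : (valueE (.reg 11)).eval s' = valueAt a m L i k := hE2.eval_valueE h9 hr
    have hB : budgetE.eval s' = budgetAt a m L i := hE2.eval_budgetE h9
    have hg := hG.eval s' P i k hE2 h8 h9 hr
    have hrest : restE.eval s' = f i (c - k) := by
      simp [restE, hf, tab, ha2, h9, hE2.r2, h12, hr, Nat.cast_sub (show k ≤ c by omega)]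
    obtain ⟨h1, h2, h3⟩ := hI
    have skip : (DemandedAt a m L P i k → 0 ≤ f i (c - k) → f i (c - k) + g P i k ≤ s'.reg 13) →
        (∀ y < k + 1, DemandedAt a m L P i y → 0 ≤ f i (c - y) →
          f i (c - y) + g P i y ≤ s'.reg 13) := fun h y hy => by
      rcases Nat.lt_succ_iff_lt_or_eq.1 hy with hy | rfl
      exacts [h1 y hy, h]
    refine Runs.when (fun hc1 => ?_) fun hc1 => ?_
    · simp only [Expr.eval_add, Expr.eval_sub, Expr.eval_mul, Expr.eval_reg, Expr.eval_one, hB, h8,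
        hr] at hc1
      refine Runs.when (fun hc2 => ?_) fun hc2 => ?_
      · simp only [Expr.eval_add, Expr.eval_sub, Expr.eval_mul, Expr.eval_reg, Expr.eval_one, hv,
          h8, hr, h10] at hc2
        have hD : DemandedAt a m L P i k := (hU k).2 ⟨hkm, by linarith, by linarith⟩
        refine Runs.when (fun hc3 => ?_) fun hc3 => ?_
        · simp only [Expr.eval_add, Expr.eval_one, hrest] at hc3
          refine Runs.when (fun hc4 => ?_) fun hc4 => ?_
          · simp only [Expr.eval_add, Expr.eval_sub, Expr.eval_reg, hrest, hg] at hc4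
            refine Runs.seq (Runs.assign ?_ (Runs.assign ?_ ?_))
            · simp only [Expr.eval_add, hrest, hg]
              have := hb.lt_of_table hG hin.le hP0 hT (show c - k ≤ m by omega)
              refine lt_of_le_of_lt (abs_add_le _ _) ?_
              rw [abs_of_nonneg (hG.nonneg P i k hP0 hin hD)]
              linarith [hG.le P i k hP0 hin hD]
            · simp only [Expr.eval_reg, State.setReg_reg, hr]
              norm_num
              exact hb.lt_of_nat (by omega)
            · simp only [Expr.eval_add, Expr.eval_reg, State.setReg_reg, hrest, hg, hr]
              norm_num
              refine ⟨fun y hy hDy h0 => ?_, by linarith, Or.inr ⟨k, by omega, rfl, hD, by linarith,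
                rfl⟩⟩
              rcases Nat.lt_or_eq_of_le hy with hy | rfl
              · linarith [h1 y hy hDy h0]
              · exact le_rfl
          · simp only [Expr.eval_add, Expr.eval_sub, Expr.eval_reg, hrest, hg] at hc4
            exact ⟨skip fun _ _ => by linarith, h2, h3⟩
        · simp only [Expr.eval_add, Expr.eval_one, hrest] at hc3
          exact ⟨skip fun _ _ => by linarith, h2, h3⟩
      · simp only [Expr.eval_add, Expr.eval_sub, Expr.eval_mul, Expr.eval_reg, Expr.eval_one, hv,
          h8, hr, h10] at hc2
        exact ⟨skip fun hD => by linarith [((hU k).1 hD).2.2], h2, h3⟩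
    · simp only [Expr.eval_add, Expr.eval_sub, Expr.eval_mul, Expr.eval_reg, Expr.eval_one, hB, h8,
        hr] at hc1
      exact ⟨skip fun hD => by linarith [((hU k).1 hD).2.1], h2, h3⟩
  · rintro s' hfr - ⟨h1, h2, h3⟩
    have hE2 := hE1.of_frame hfr rfl rfl rfl rfl rfl
    have h9 : s'.reg 9 = i := (hfr.reg 9 rfl).trans (by simp [hs₁, hi])
    have h12 : s'.reg 12 = c := (hfr.reg 12 rfl).trans (by simp [hs₁, hc])
    have ha2 : s'.arr 2 = s.arr 2 := (hfr.arr 2 rfl).trans (by simp [hs₁])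
    have ha3 : s'.arr 3 = s.arr 3 := (hfr.arr 3 rfl).trans (by simp [hs₁])
    -- The values to be stored are contents of registers, so the bit bound of the current state
    -- already covers them.
    intro hbdd
    refine Runs.seq (Runs.store ?_ (Runs.store ?_ ?_)) hbdd
    · exact hbdd.1 13
    · exact hbdd.1 14
    · have hidx : ∀ s'' : State, s''.reg = s'.reg →
          cellIndexE.eval s'' = ((i + 1 : ℕ) : ℤ) * (m + 1) + c := by
        intro s'' h
        simp [cellIndexE, h, h9, hE2.r2, h12]
      rw [hidx s' rfl, hidx (s'.setArr _ _ _) rfl]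
      simp only [Expr.eval_reg, State.setArr_reg]
      have key : ∀ j : ℕ, ∀ d ≤ m, ((j : ℤ) * (m + 1) + d = ((i + 1 : ℕ) : ℤ) * (m + 1) + c) ↔
          (j = i + 1 ∧ d = c) := fun j d hd =>
        ⟨fun h => cell_index_inj hd hcm h, by rintro ⟨rfl, rfl⟩; rfl⟩
      generalize hs₂ : (s'.setArr 2 (((i + 1 : ℕ) : ℤ) * (m + 1) + c) (s'.reg 13)).setArr 3
        (((i + 1 : ℕ) : ℤ) * (m + 1) + c) (s'.reg 14) = s₂
      have hnew : ∀ j, ∀ d ≤ m, (j = i + 1 → d ≠ c) → tab m (s₂.arr 2) j d = f j d ∧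
          tab m (s₂.arr 3) j d = tab m (s.arr 3) j d := by
        intro j d hd hne
        have : ¬ (j = i + 1 ∧ d = c) := fun h => hne h.1 h.2
        rw [← key j d hd] at this
        simp only [← hs₂, tab, State.setArr_arr, this, hf, ha2, ha3]
        simp
      have hf1 : tab m (s₂.arr 2) (i + 1) c = s'.reg 13 := by simp [← hs₂, tab]
      have hc1 : tab m (s₂.arr 3) (i + 1) c = s'.reg 14 := by simp [← hs₂, tab]
      refine ⟨⟨fun y hy hD => ?_, ?_⟩, hnew⟩
      · rw [hf1, (hnew i (c - y) (by omega) (by omega)).1]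
        exact h1 y (by omega) hD
      · rw [hf1, hc1]
        refine h3.imp_right ?_
        rintro ⟨y, hy, h4, h5, h6, h7⟩
        refine ⟨y, hy, h4, h5, ?_⟩
        rw [(hnew i (c - y) (by omega) (by omega)).1]
        exact ⟨h6, h7⟩

theorem runs_rowCmd (hE : Env a n m L s) (hb : Bounds a n m L H R K)
    (hG : GainSpec gain g a n m L H) {i : ℕ} {P : ℤ}
    (hi : s.reg 9 = i) (hin : i < n) (hP : s.reg 8 = P) (hP0 : 0 ≤ P)
    (hT : IsTable (DemandedAt a m L P) (g P) i m (tab m (s.arr 2)) (tab m (s.arr 3))) :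
    Runs R K (rowCmd gain) s fun s' =>
      IsTable (DemandedAt a m L P) (g P) (i + 1) m (tab m (s'.arr 2)) (tab m (s'.arr 3)) := by
  refine Runs.seq ((runs_utilityCmd hE hb hi hin hP hP0).mono fun s₁ hf1 hU => ?_)
  have hE1 := hE.of_frame hf1 rfl rfl rfl rfl rfl
  rw [← hf1.arr 2 rfl, ← hf1.arr 3 rfl] at hT
  refine Runs.forTo (fun c s' =>
    IsTable (DemandedAt a m L P) (g P) i m (tab m (s'.arr 2)) (tab m (s'.arr 3)) ∧
    ∀ d < c, IsCell (DemandedAt a m L P) (g P) (tab m (s'.arr 2)) (tab m (s'.arr 3)) i d)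
    (m + 1) hb.m_lt (hb.lt_of_nat hb.m_lt) rfl ?_ ?_ ?_ ?_ ?_
  · intro s' hf
    simp [(hE1.of_frame hf rfl rfl rfl rfl rfl).r2]
  · exact ⟨hT, fun d hd => absurd hd (Nat.not_lt_zero d)⟩
  · exact fun _ _ _ h => h
  · rintro c s' hc hf hr ⟨h1, h2⟩
    refine (runs_cellCmd (hE1.of_frame hf rfl rfl rfl rfl rfl) hb hG
      ((hf.reg 9 rfl).trans ((hf1.reg 9 rfl).trans hi)) hin
      ((hf.reg 8 rfl).trans ((hf1.reg 8 rfl).trans hP)) hP0 ?_ h1 hr (by omega)).mono ?_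
    · rwa [hf.reg 10 rfl]
    rintro s'' - ⟨h3, h4⟩
    refine ⟨h1.congr (fun j hj d hd => (h4 j d hd (by omega)).1)
      (fun j hj d hd => (h4 j d hd (by omega)).2), fun d hd => ?_⟩
    rcases Nat.lt_succ_iff_lt_or_eq.1 hd with hd | rfl
    · exact (h2 d hd).congr (fun c' hc' => (h4 _ _ (by omega) (by omega)).1)
        (h4 _ _ (by omega) (by omega)).1 (h4 _ _ (by omega) (by omega)).2
    · exact h3
  · rintro s' - - ⟨h1, h2⟩
    refine ⟨h1.zero, fun j hj c hc => ?_⟩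
    rcases Nat.lt_succ_iff_lt_or_eq.1 hj with hj | rfl
    exacts [h1.cell j hj c hc, h2 c (by omega)]

/-- The table is never cleared between prices: rows from 1 on are overwritten, and row 0 keeps its
initial zeros. -/
theorem runs_tableCmd (hE : Env a n m L s) (hb : Bounds a n m L H R K)
    (hG : GainSpec gain g a n m L H) {P : ℤ} (hP : s.reg 8 = P) (hP0 : 0 ≤ P)
    (h0 : ∀ c ≤ m, tab m (s.arr 2) 0 c = 0) :
    Runs R K (tableCmd gain) s fun s' =>
      IsTable (DemandedAt a m L P) (g P) n m (tab m (s'.arr 2)) (tab m (s'.arr 3)) := by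
  refine Runs.forTo (fun i s' =>
    IsTable (DemandedAt a m L P) (g P) i m (tab m (s'.arr 2)) (tab m (s'.arr 3)))
    n hb.n_le (hb.lt_of_nat hb.n_le) rfl ?_ ?_ ?_ ?_ ?_
  · intro s' hf
    simp [(hE.of_frame hf rfl rfl rfl rfl rfl).r1]
  · exact ⟨h0, fun i hi => absurd hi (Nat.not_lt_zero i)⟩
  · exact fun _ _ _ h => h
  · intro i s' hi hf hr hT
    exact runs_rowCmd (hE.of_frame hf rfl rfl rfl rfl rfl) hb hG hr hi
      ((hf.reg 8 rfl).trans hP) hP0 hT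
  · exact fun _ _ _ h => h

/-- The allocation `x` is envy-free at the price `P`. -/
def EnvyFreeAt (a : ℤ → ℤ) (n m : ℕ) (L P : ℤ) (x : ℕ → ℕ) : Prop :=
  (∀ j < n, DemandedAt a m L P j (x j)) ∧ ∑ j ∈ range n, x j ≤ m

/-- After `k` rounds the last `k` buyers are served and `c` units remain. The invariant is that
their gains plus the entry at row `n - k`, column `c` give the optimum; at row 0 that entry is 0. -/
theorem runs_extractCmd (hE : Env a n m L s) (hb : Bounds a n m L H R K) {P : ℤ}
    (hT : IsTable (DemandedAt a m L P) (g P) n m (tab m (s.arr 2)) (tab m (s.arr 3)))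
    (h0 : 0 ≤ tab m (s.arr 2) n m) :
    Runs R K extractCmd s fun s' => s'.arr 1 0 = s.arr 1 0 ∧ s'.arr 1 1 = s.arr 1 1 ∧
      ∃ x : ℕ → ℕ, (∀ j < n, s'.arr 1 (2 + j) = x j) ∧ EnvyFreeAt a n m L P x ∧
        ∑ j ∈ range n, g P j (x j) = tab m (s.arr 2) n m := by
  have hmR : m ≤ R := (Nat.le_succ m).trans hb.m_lt
  refine Runs.seq (Runs.assign (by simpa [hE.r2] using hb.lt_of_nat hmR) ?_)
  set s₁ := s.setReg 12 ((Expr.reg 2).eval s) with hs₁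
  have hE1 : Env a n m L s₁ := ⟨by simp [hs₁, hE.r1], by simp [hs₁, hE.r2], by simp [hs₁, hE.r3],
    by simp [hs₁, hE.r4], by simp [hs₁, hE.a0]⟩
  refine Runs.forTo (fun k s' => s'.arr 1 0 = s.arr 1 0 ∧ s'.arr 1 1 = s.arr 1 1 ∧
    ∃ (c : ℕ) (x : ℕ → ℕ), s'.reg 12 = c ∧
      (∀ j, n - k ≤ j → j < n → s'.arr 1 (2 + j) = x j ∧ DemandedAt a m L P j (x j)) ∧
      c + ∑ j ∈ Ico (n - k) n, x j = m ∧ 0 ≤ tab m (s.arr 2) (n - k) c ∧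
      tab m (s.arr 2) (n - k) c + ∑ j ∈ Ico (n - k) n, g P j (x j) = tab m (s.arr 2) n m)
    n hb.n_le (hb.lt_of_nat hb.n_le) rfl ?_ ?_ ?_ ?_ ?_
  · intro s' hf
    simp [(hE1.of_frame hf rfl rfl rfl rfl rfl).r1]
  · refine ⟨by simp [hs₁], by simp [hs₁], m, fun _ => 0, by simp [hs₁, hE.r2],
      fun j hj hj' => absurd hj (by omega), by simp, by simpa using h0, by simp⟩
  · intro k s' z h
    simpa using h
  · rintro k s' hk hf hr ⟨hp, hl, c, x, h12, h1, h2, h3, h4⟩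
    have hE2 := hE1.of_frame hf rfl rfl rfl rfl rfl
    have ha3 : s'.arr 3 = s.arr 3 := (hf.arr 3 rfl).trans (by simp [hs₁])
    obtain ⟨i, hi⟩ : ∃ i, n - k = i + 1 := ⟨n - k - 1, by omega⟩
    have hik : n - (k + 1) = i := by omega
    rw [hi] at h1 h2 h3 h4
    have hcm : c ≤ m := by omega
    obtain he | ⟨y, hy, hch, hD, h5, h6⟩ := (hT.cell i (by omega) c hcm).attained
    -- The traceback stays on nonnegative entries, so it never meets the sentinel.
    · rw [he] at h3; omega
    have hnk : (n : ℤ) - k = (i + 1 : ℕ) := by omega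
    have hy' : (Expr.read 3 ((.reg 1 - .reg 9) * (.reg 2 + 1) + .reg 12)).eval s' = y := by
      simp only [Expr.eval_read, Expr.eval_add, Expr.eval_mul, Expr.eval_sub, Expr.eval_reg,
        Expr.eval_one, hE2.r1, hr, hE2.r2, h12, ha3, hnk]
      exact hch
    have hbig : ∀ z : ℕ, z ≤ m → |(z : ℤ)| < 2 ^ K := fun z hz => by
      rw [abs_of_nonneg (Int.natCast_nonneg z)]
      exact hb.lt_of_nat (hz.trans hmR)
    refine Runs.seq (Runs.assign (by rw [hy']; exact hbig y (hy.trans hcm)) ?_)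
    rw [hy']
    refine Runs.seq (Runs.store (by simpa using hbig y (hy.trans hcm)) ?_)
    have hidx : (1 + Expr.reg 1 - Expr.reg 9 : Expr).eval (s'.setReg 11 y) = 2 + i := by
      simp [hE2.r1, hr]; omega
    rw [hidx]
    have hcy : (c : ℤ) - y = (c - y : ℕ) := by omega
    refine Runs.assign (by simpa [h12, hcy] using hbig (c - y) (by omega)) ?_
    rw [hik]
    refine ⟨?_, ?_, c - y, Function.update x i y, by simp [h12, hcy], fun j hj hjn => ?_, ?_, h5, ?_⟩
    · rw [← hp]
      have : ¬ ((0 : ℤ) = 2 + i) := by omega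
      simp [this]
    · rw [← hl]
      have : ¬ ((1 : ℤ) = 2 + i) := by omega
      simp [this]
    · rcases Nat.eq_or_lt_of_le hj with rfl | hj
      · simpa using hD
      · have hne : j ≠ i := by omega
        simpa [hne] using h1 j hj hjn
    · have : ∑ j ∈ Ico (i + 1) n, Function.update x i y j = ∑ j ∈ Ico (i + 1) n, x j :=
        sum_congr rfl fun j hj => Function.update_of_ne (by have := (mem_Ico.1 hj).1; omega) _ _
      rw [sum_eq_sum_Ico_succ_bot (by omega), this, Function.update_self]
      omega
    · have : ∑ j ∈ Ico (i + 1) n, g P j (Function.update x i y j) =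
          ∑ j ∈ Ico (i + 1) n, g P j (x j) := sum_congr rfl fun j hj => by
        rw [Function.update_of_ne (by have := (mem_Ico.1 hj).1; omega)]
      rw [sum_eq_sum_Ico_succ_bot (by omega), this, Function.update_self]
      linarith
  · rintro s' - - ⟨hp, hl, c, x, -, h1, h2, -, h4⟩
    rw [Nat.sub_self] at h1 h2 h4
    rw [← range_eq_Ico] at h2 h4
    refine ⟨hp, hl, x, fun j hj => (h1 j (Nat.zero_le j) hj).1,
      ⟨fun j hj => (h1 j (Nat.zero_le j) hj).2, by omega⟩, ?_⟩
    rw [← h4, hT.zero c (by omega), zero_add]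

end RAM

/-! ### The search over all candidate prices and the whole program. -/

namespace RAM
open Finset
variable {a : ℤ → ℤ} {n m : ℕ} {L : ℤ} {s s' : State} {R K : ℕ} {H : ℤ}
variable {gain : Expr} {g : ℤ → ℕ → ℕ → ℤ}

/-- Array 1 holds the best envy-free pricing at the prices in `S`, and register 15 its objective
(`-1` if there is none). -/
structure Found (g : ℤ → ℕ → ℕ → ℤ) (a : ℤ → ℤ) (n m : ℕ) (L : ℤ) (S : ℤ → Prop) (s : State) :
    Prop where
  row : ∀ c ≤ m, tab m (s.arr 2) 0 c = 0
  upper : ∀ P, S P → ∀ x, EnvyFreeAt a n m L P x → ∑ j ∈ range n, g P j (x j) ≤ s.reg 15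
  attained : s.reg 15 = -1 ∨ ∃ P x, 0 ≤ P ∧ s.arr 1 0 = P ∧ s.arr 1 1 = L ∧
    (∀ j < n, s.arr 1 (2 + j) = (x j : ℕ)) ∧ EnvyFreeAt a n m L P x ∧
    ∑ j ∈ range n, g P j (x j) = s.reg 15

theorem GainSpec.sum_nonneg (hG : GainSpec gain g a n m L H) {P : ℤ} (hP0 : 0 ≤ P) {x : ℕ → ℕ}
    (hx : EnvyFreeAt a n m L P x) : 0 ≤ ∑ j ∈ range n, g P j (x j) :=
  Finset.sum_nonneg fun j hj =>
    hG.nonneg P j _ hP0 (mem_range.1 hj) (hx.1 j (mem_range.1 hj))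

theorem runs_tryCmd (hE : Env a n m L s) (hb : Bounds a n m L H R K)
    (hG : GainSpec gain g a n m L H) {P : ℤ} (hP : s.reg 8 = P) (hP0 : 0 ≤ P) {S : ℤ → Prop}
    (hS : Found g a n m L S s) :
    Runs R K (tryCmd gain) s (Found g a n m L fun Q => S Q ∨ Q = P) := by
  refine Runs.seq ((runs_tableCmd hE hb hG hP hP0 hS.row).mono fun s₁ hf hT => ?_)
  have hE1 := hE.of_frame hf rfl rfl rfl rfl rfl
  have h15 : s₁.reg 15 = s.reg 15 := hf.reg 15 rfl
  have hlast : lastE.eval s₁ = tab m (s₁.arr 2) n m := by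
    simp [lastE, tab, hE1.r1, hE1.r2]
  have hub : ∀ x, EnvyFreeAt a n m L P x → ∑ j ∈ range n, g P j (x j) ≤ tab m (s₁.arr 2) n m :=
    fun x hx => hT.sum_le (fun j hj y hD => hG.nonneg P j y hP0 hj hD) x n le_rfl m le_rfl hx.1 hx.2
  refine Runs.when (fun hc => ?_) fun hc => ?_
  · rw [Expr.eval_sub, hlast, Expr.eval_reg, h15] at hc
    -- With this bound a strict improvement forces the last entry of the table to be nonnegative, so
    -- that an allocation can be traced back.
    have hF : -1 ≤ s.reg 15 := by
      rcases hS.attained with h | ⟨Q, x, hQ, -, -, -, hx, h⟩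
      · exact h.ge
      · rw [← h]
        linarith [hG.sum_nonneg hQ hx]
    refine Runs.seq (Runs.assign ?_ ?_)
    · rw [hlast]
      have := hb.lt_of_table hG le_rfl hP0 hT (le_refl m)
      linarith [hb.H_nonneg]
    rw [hlast]
    intro hbdd
    refine Runs.seq (Runs.store (hbdd.1 8) (Runs.seq (Runs.store (hbdd.1 3) ?_))) hbdd
    generalize hs₂ : ((s₁.setReg 15 (tab m (s₁.arr 2) n m)).setArr 1 _ _).setArr 1 _ _ = s₂
    have h8 : s₁.reg 8 = P := (hf.reg 8 rfl).trans hP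
    have hE2 : Env a n m L s₂ := by
      constructor
      · simp [← hs₂, hE1.r1]
      · simp [← hs₂, hE1.r2]
      · simp [← hs₂, hE1.r3]
      · simp [← hs₂, hE1.r4]
      · funext j; simp [← hs₂, hE1.a0]
    have ha2 : s₂.arr 2 = s₁.arr 2 := by funext j; simp [← hs₂]
    have ha3 : s₂.arr 3 = s₁.arr 3 := by funext j; simp [← hs₂]
    have hr : s₂.reg 15 = tab m (s₁.arr 2) n m := by simp [← hs₂]
    have hp : s₂.arr 1 0 = P := by simp [← hs₂, h8]
    have hl : s₂.arr 1 1 = L := by simp [← hs₂, hE1.r3]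
    refine (runs_extractCmd hE2 hb (P := P) (g := g) (by rwa [ha2, ha3])
      (by rw [ha2]; linarith)).mono ?_
    rintro s₃ hf3 ⟨h0, h1, x, hx, hef, hsum⟩
    have hr3 : s₃.reg 15 = tab m (s₁.arr 2) n m := (hf3.reg 15 rfl).trans hr
    refine ⟨?_, ?_, Or.inr ⟨P, x, hP0, h0.trans hp, h1.trans hl, hx, hef, ?_⟩⟩
    · rw [hf3.arr 2 rfl, ha2]
      exact hT.zero
    · rw [hr3]
      rintro Q (hQ | rfl) y hy
      · linarith [hS.upper Q hQ y hy]
      · exact hub y hy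
    · rw [hsum, ha2, hr3]
  · rw [Expr.eval_sub, hlast, Expr.eval_reg, h15] at hc
    refine ⟨hT.zero, ?_, ?_⟩
    · rw [h15]
      rintro Q (hQ | rfl) y hy
      · exact hS.upper Q hQ y hy
      · linarith [hub y hy]
    · rw [h15, hf.arr 1 rfl]
      exact hS.attained

theorem eval_modE {e f : Expr} {x y : ℕ} (he : e.eval s = x) (hf : f.eval s = y) :
    (modE e f).eval s = (x % y : ℕ) := by
  simp only [modE, Expr.eval_sub, Expr.eval_mul, Expr.eval_div, he, hf]
  push_cast
  rw [Int.emod_def]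
  ring

theorem Env.eval_candidateE (hE : Env a n m L s) {t : ℕ} (ht : s.reg 5 = t) :
    candidateE.eval s = candidate a (n * (m + 2)) m L t := by
  have h1 : (Expr.reg 5 / (.reg 2 + 1) : Expr).eval s = (t / (m + 1) : ℕ) := by
    simp [ht, hE.r2]
  have h2 : (Expr.reg 4 + 1 : Expr).eval s = (n * (m + 2) + 1 : ℕ) := by
    simp [hE.r4]
  have h3 : (Expr.reg 2 + 1 : Expr).eval s = (m + 1 : ℕ) := by simp [hE.r2]
  have h4 : (Expr.reg 5 / (.reg 2 + 1) / (.reg 4 + 1) : Expr).eval s =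
      (t / (m + 1) / (n * (m + 2) + 1) : ℕ) := by
    rw [Expr.eval_div, h1, h2]; simp
  rw [candidateE, Expr.eval_div, Expr.eval_sub, hE.eval_entryE h4,
    hE.eval_entryE (eval_modE h1 h2), eval_modE (e := .reg 5) ht h3, candidate]

theorem Bounds.abs_candidate_le (hb : Bounds a n m L H R K) {t : ℕ}
    (ht : t < (n * (m + 2) + 1) * (n * (m + 2) + 1) * (m + 1)) :
    |candidate a (n * (m + 2)) m L t| ≤ 2 * H := by
  refine (Int.abs_ediv_le_abs _ _).trans ((abs_sub _ _).trans ?_)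
  have h1 := hb.entry_le (t / (m + 1) / (n * (m + 2) + 1)) (by
    rw [← Nat.lt_succ_iff, Nat.div_lt_iff_lt_mul (by omega), Nat.div_lt_iff_lt_mul (by omega)]
    exact ht)
  have h2 := hb.entry_le (t / (m + 1) % (n * (m + 2) + 1))
    (Nat.lt_succ_iff.1 (Nat.mod_lt _ (by omega)))
  linarith

theorem runs_searchCmd (hE : Env a n m L s) (hb : Bounds a n m L H R K)
    (hG : GainSpec gain g a n m L H) (h0 : ∀ c ≤ m, tab m (s.arr 2) 0 c = 0) :
    Runs R K (searchCmd gain) s (Found g a n m L fun P => 0 ≤ P ∧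
      ∃ t < (n * (m + 2) + 1) * (n * (m + 2) + 1) * (m + 1),
        P = candidate a (n * (m + 2)) m L t) := by
  refine Runs.seq (Runs.assign (by simp; linarith [hb.R_lt]) ?_)
  set s₁ := s.setReg 15 ((Expr.const (-1)).eval s) with hs₁
  have hE1 : Env a n m L s₁ := ⟨by simp [hs₁, hE.r1], by simp [hs₁, hE.r2], by simp [hs₁, hE.r3],
    by simp [hs₁, hE.r4], by simp [hs₁, hE.a0]⟩
  refine Runs.forTo (fun k => Found g a n m L fun P => 0 ≤ P ∧
    ∃ t < k, P = candidate a (n * (m + 2)) m L t) _ hb.rounds (hb.lt_of_nat hb.rounds) rfl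
    ?_ ?_ ?_ ?_ ?_
  · intro s' hf
    have hE2 := hE1.of_frame hf rfl rfl rfl rfl rfl
    simp [hE2.r4, hE2.r2]
  · exact ⟨by simpa [hs₁] using h0, fun P ⟨_, t, ht, _⟩ => absurd ht (Nat.not_lt_zero t),
      Or.inl (by simp [hs₁])⟩
  · intro k s' z h
    exact ⟨h.row, by simpa using h.upper, by simpa using h.attained⟩
  · intro t s' ht hf hr hI
    have hE2 := hE1.of_frame hf rfl rfl rfl rfl rfl
    have hc := hE2.eval_candidateE hr
    refine Runs.seq (Runs.assign (by rw [hc]; exact hb.lt_of_le (hb.abs_candidate_le ht)) ?_)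
    rw [hc]
    generalize hP : candidate a (n * (m + 2)) m L t = P
    have hE3 : Env a n m L (s'.setReg 8 P) := ⟨by simp [hE2.r1], by simp [hE2.r2],
      by simp [hE2.r3], by simp [hE2.r4], by simp [hE2.a0]⟩
    have hI' : Found g a n m L (fun P => 0 ≤ P ∧ ∃ u < t, P = candidate a (n * (m + 2)) m L u)
      (s'.setReg 8 P) := ⟨hI.row, by simpa using hI.upper, by simpa using hI.attained⟩
    -- Negative candidates are skipped, since they are not prices.
    refine Runs.when (fun hpos => ?_) fun hneg => ?_
    · have hP0 : 0 ≤ P := by simpa [Int.lt_add_one_iff] using hpos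
      refine (runs_tryCmd hE3 hb hG (by simp) hP0 hI').mono fun s'' _ hF => ⟨hF.row, ?_, hF.attained⟩
      rintro Q ⟨hQ, u, hu, rfl⟩
      refine hF.upper _ ?_
      rcases Nat.lt_succ_iff_lt_or_eq.1 hu with hu | rfl
      exacts [Or.inl ⟨hQ, u, hu, rfl⟩, Or.inr hP]
    · refine ⟨hI'.row, ?_, hI'.attained⟩
      rintro Q ⟨hQ, u, hu, rfl⟩
      refine hI'.upper _ ⟨hQ, u, ?_, rfl⟩
      rcases Nat.lt_succ_iff_lt_or_eq.1 hu with hu | rfl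
      · exact hu
      · simp at hneg
        omega
  · exact fun _ _ _ h => h

/-- The common scale after `k` rounds. -/
def scale (a : ℤ → ℤ) (k : ℕ) : ℤ := ∏ j ∈ range k, (a (2 * j + 4) * (j + 1))

theorem runs_scaleCmd {N : ℕ} (h4 : s.reg 4 = N) (h0 : s.arr 0 = a) (hN : N ≤ R)
    (hNK : (N : ℤ) < 2 ^ K) (hK : ∀ k ≤ N, |scale a k| < 2 ^ K) :
    Runs R K scaleCmd s fun s' => s'.reg 3 = scale a N := by
  have h1 := hK 0 (Nat.zero_le N)
  refine Runs.seq (Runs.assign (by simpa [scale] using h1) ?_)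
  refine Runs.forTo (fun k s' => s'.reg 3 = scale a k) N hN hNK rfl ?_ ?_ ?_ ?_ ?_
  · intro s' hf
    rw [Expr.eval_reg, hf.reg 4 rfl]
    simpa using h4
  · simp [scale]
  · intro k s' z h
    simpa using h
  · intro k s' hk hf hr hI
    have ha : s'.arr 0 = a := (hf.arr 0 rfl).trans h0
    have he : (Expr.reg 3 * (.read 0 (2 * .reg 5 + 4) * (.reg 5 + 1)) : Expr).eval s' =
        scale a (k + 1) := by
      simp [hI, ha, hr, scale, prod_range_succ]
    refine Runs.assign ?_ ?_
    · rw [he]; exact hK _ hk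
    · rw [he]; simp
  · exact fun _ _ _ h => h

theorem runs_mainCmd_pos (h0 : s.arr 0 = a) (hn : a 1 = n) (hm : a 2 = m) (hpos : 0 < n)
    (hb : Bounds a n m (scale a (n * (m + 2))) H R K)
    (hG : GainSpec gain g a n m (scale a (n * (m + 2))) H)
    (hs : ∀ k ≤ n * (m + 2), |scale a k| < 2 ^ K) (h2 : ∀ j, s.arr 2 j = 0) :
    Runs R K (mainCmd gain) s fun s' => s'.reg 0 = n + 2 ∧
      Found g a n m (scale a (n * (m + 2))) (fun P => 0 ≤ P ∧
        ∃ t < (n * (m + 2) + 1) * (n * (m + 2) + 1) * (m + 1),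
          P = candidate a (n * (m + 2)) m (scale a (n * (m + 2))) t) s' := by
  have hNR : n * (m + 2) ≤ R := by
    refine le_trans ?_ hb.rounds
    refine le_trans ?_ (Nat.le_mul_of_pos_right _ (by positivity))
    nlinarith
  have hbig : ∀ k : ℕ, k ≤ R + 1 → |(k : ℤ)| < 2 ^ K := fun k hk => by
    have : (k : ℤ) ≤ R + 1 := by exact_mod_cast hk
    rw [abs_of_nonneg (Int.natCast_nonneg k)]
    linarith [hb.R_lt]
  refine Runs.seq (Runs.assign ?_ (Runs.seq (Runs.assign ?_ ?_)))
  · simpa [h0, hn] using hbig n (hb.n_le.trans (Nat.le_succ R))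
  · simpa [h0, hm] using hbig m (by have := hb.m_lt; omega)
  simp only [Expr.eval_read, Expr.eval_one, Expr.eval_ofNat, State.setReg_arr, h0, hn, hm]
  refine Runs.cond (fun _ => ?_) fun h => absurd h (by simpa using hpos.ne')
  refine Runs.seq (Runs.assign ?_ ?_)
  · simpa using hbig (n * (m + 2)) (by omega)
  refine Runs.seq ((runs_scaleCmd (N := n * (m + 2)) (a := a) (by simp) (by simpa using h0) hNR
    (hb.lt_of_nat hNR) hs).mono fun s₁ hf h3 => ?_)
  have hE : Env a n m (scale a (n * (m + 2))) s₁ := ⟨by rw [hf.reg 1 rfl]; simp,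
    by rw [hf.reg 2 rfl]; simp, h3, by rw [hf.reg 4 rfl]; simp, by rw [hf.arr 0 rfl]; simpa using h0⟩
  refine Runs.seq ((runs_searchCmd hE hb hG ?_).mono fun s₂ hf2 hF => ?_)
  · intro c _
    rw [hf.arr 2 rfl]
    exact h2 _
  have h1 : s₂.reg 1 = n := (hf2.reg 1 rfl).trans hE.r1
  refine Runs.assign ?_ ⟨by simp [h1], hF.row, by simpa using hF.upper, by simpa using hF.attained⟩
  have : n + 2 ≤ R + 1 := by
    have : 1 * (n * (m + 2) + 1) ≤ (n * (m + 2) + 1) * (n * (m + 2) + 1) :=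
      Nat.mul_le_mul_right _ (by omega)
    have : (n * (m + 2) + 1) * (n * (m + 2) + 1) * 1 ≤ R :=
      (Nat.mul_le_mul_left _ (by omega)).trans hb.rounds
    nlinarith
  simpa [h1] using hbig (n + 2) this

theorem runs_mainCmd_zero (h1 : s.arr 0 1 = 0) (hm : |s.arr 0 2| < 2 ^ K) (hK : 2 ≤ K)
    (h0 : s.arr 1 0 = 0) :
    Runs R K (mainCmd gain) s fun s' => s'.reg 0 = 2 ∧ s'.arr 1 0 = 0 ∧ s'.arr 1 1 = 1 := by
  have h4 : (2 : ℤ) ^ 2 ≤ 2 ^ K := pow_le_pow_right₀ (by norm_num) hK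
  refine Runs.seq (Runs.assign (by simp [h1]) (Runs.seq (Runs.assign (by simpa using hm) ?_)))
  refine Runs.cond (fun h => absurd h (by simp [h1])) fun _ => ?_
  refine Runs.seq (Runs.store (by simp; omega) (Runs.assign (by simp; omega) ?_))
  simp [h0]

end RAM

namespace Market
open Finset RAM

/-! ### The encoding -/

/-- All amounts of the market: for every buyer its budget and all its values. -/
def amounts (M : Market) : List ℚ :=
  (List.ofFn fun i : Fin M.n => M.budget i :: List.ofFn (M.value i)).flatten

theorem encode_eq (M : Market) :
    M.encode = (M.n : ℤ) :: (M.m : ℤ) :: M.amounts.flatMap ratWords := by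
  simp [encode, amounts, List.flatMap, List.map_flatten, List.flatten_flatten, List.map_ofFn,
    Function.comp_def]

theorem getD_flatten_ofFn {α : Type*} {n l : ℕ} (f : Fin n → List α) (hf : ∀ i, (f i).length = l)
    (i : Fin n) {j : ℕ} (hj : j < l) (z : α) :
    (List.ofFn f).flatten.getD (i * l + j) z = (f i).getD j z := by
  induction n with
  | zero => exact i.elim0
  | succ n ih =>
    rw [List.ofFn_succ, List.flatten_cons]
    refine Fin.cases ?_ (fun i => ?_) i
    · rw [Fin.val_zero, zero_mul, zero_add, List.getD_append _ _ _ _ (by rw [hf]; exact hj)]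
    · rw [List.getD_append_right _ _ _ _ (by rw [hf, Fin.val_succ]; nlinarith), hf, Fin.val_succ,
        show (i + 1 : ℕ) * l + j - l = i * l + j by rw [add_mul]; omega]
      exact ih (fun i => f i.succ) (fun i => hf _) i

theorem getD_flatMap_ratWords_even (l : List ℚ) (k : ℕ) :
    (l.flatMap ratWords).getD (2 * k) 0 = (l.getD k 0).num := by
  induction l generalizing k with
  | nil => simp
  | cons r l ih =>
    cases k with
    | zero => simp [ratWords]
    | succ k => simpa [ratWords, mul_add] using ih k

theorem getD_flatMap_ratWords_odd (l : List ℚ) (k : ℕ) (hk : k < l.length) :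
    (l.flatMap ratWords).getD (2 * k + 1) 0 = (l.getD k 0).den := by
  induction l generalizing k with
  | nil => simp at hk
  | cons r l ih =>
    cases k with
    | zero => simp [ratWords]
    | succ k => simpa [ratWords, mul_add] using ih k (by simpa using hk)

theorem length_amounts (M : Market) : M.amounts.length = M.n * (M.m + 2) := by
  simp [amounts, List.length_flatten, List.map_ofFn, Function.comp_def]

theorem length_flatMap_ratWords (l : List ℚ) : (l.flatMap ratWords).length = 2 * l.length := by
  induction l with
  | nil => rfl
  | cons r l ih => simp [ratWords] at ih ⊢; omega

theorem length_encode (M : Market) : M.encode.length = 2 * (M.n * (M.m + 2)) + 2 := by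
  rw [encode_eq, List.length_cons, List.length_cons, length_flatMap_ratWords, length_amounts]

def amount (M : Market) (k : ℕ) : ℚ := M.amounts.getD k 0

theorem amount_budget (M : Market) (i : Fin M.n) : M.amount (i * (M.m + 2)) = M.budget i := by
  have := getD_flatten_ofFn (fun i : Fin M.n => M.budget i :: List.ofFn (M.value i))
    (l := M.m + 2) (fun i => by simp) i (j := 0) (by omega) 0
  exact this

theorem amount_value (M : Market) (i : Fin M.n) (y : Fin (M.m + 1)) :
    M.amount (i * (M.m + 2) + 1 + y) = M.value i y := by
  have := getD_flatten_ofFn (fun i : Fin M.n => M.budget i :: List.ofFn (M.value i))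
    (l := M.m + 2) (fun i => by simp) i (j := y + 1) (by omega) 0
  rw [add_assoc, add_comm 1]
  refine this.trans ?_
  rw [List.getD_cons_succ, List.getD_eq_getElem _ _ (by simpa using y.2),
    List.getElem_ofFn]

/-- The contents of array 0 at the start. -/
def cells (M : Market) (E : ℤ) : ℤ → ℤ := (State.initial (E :: M.encode)).arr 0

variable (M : Market) (E : ℤ)

theorem cells_one : M.cells E 1 = M.n := by
  simp [cells, State.initial, encode]

theorem cells_two : M.cells E 2 = M.m := by
  simp [cells, State.initial, encode]

theorem cells_num (k : ℕ) : M.cells E (2 * k + 3) = (M.amount k).num := by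
  have h : ((2 * k + 3 : ℤ)).toNat = 2 * k + 1 + 1 + 1 := by omega
  have h0 : (0 : ℤ) ≤ 2 * k + 3 := by positivity
  rw [cells, State.initial, encode_eq]
  simp only [h, h0, and_self, if_true, List.getD_cons_succ]
  exact getD_flatMap_ratWords_even _ k

theorem cells_den (k : ℕ) (hk : k < M.n * (M.m + 2)) :
    M.cells E (2 * k + 4) = (M.amount k).den := by
  have h : ((2 * k + 4 : ℤ)).toNat = 2 * k + 1 + 1 + 1 + 1 := by omega
  have h0 : (0 : ℤ) ≤ 2 * k + 4 := by positivity
  rw [cells, State.initial, encode_eq]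
  simp only [h, h0, and_self, if_true, List.getD_cons_succ]
  exact getD_flatMap_ratWords_odd _ k (by rwa [length_amounts])

/-! ### The scaled market -/

/-- The common scale. -/
def commonScale : ℤ := scale (M.cells E) (M.n * (M.m + 2))

theorem commonScale_pos : 0 < M.commonScale E := by
  rw [commonScale, scale]
  refine prod_pos fun j hj => ?_
  rw [cells_den M E j (mem_range.1 hj)]
  have := (M.amount j).den_pos
  positivity

/-- The scale is the product of all denominators times a factorial. Removing one denominator leaves
the factorial in `u`, so scaled amounts remain divisible by every small `d`. -/
theorem commonScale_eq {k : ℕ} (hk : k < M.n * (M.m + 2)) :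
    ∃ u, M.commonScale E = (M.amount k).den * u ∧
      ∀ d : ℕ, 1 ≤ d → d ≤ M.n * (M.m + 2) → (d : ℤ) ∣ u := by
  refine ⟨(∏ j ∈ (range (M.n * (M.m + 2))).erase k, M.cells E (2 * j + 4)) *
    ∏ j ∈ range (M.n * (M.m + 2)), ((j : ℤ) + 1), ?_, fun d h1 hd => ?_⟩
  · rw [← mul_assoc, ← cells_den M E k hk,
      mul_prod_erase _ (fun j : ℕ => M.cells E (2 * j + 4)) (mem_range.2 hk), commonScale, scale,
      prod_mul_distrib]
  · refine Dvd.dvd.mul_left ?_ _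
    have h : d - 1 ∈ range (M.n * (M.m + 2)) := mem_range.2 (by omega)
    have := dvd_prod_of_mem (fun j : ℕ => (j : ℤ) + 1) h
    rwa [Nat.cast_sub h1, Nat.cast_one, sub_add_cancel] at this

/-- The index just past the list serves as an amount equal to zero. It makes `B / y` a candidate of
the same shape as `(V y - V z) / (y - z)`. -/
theorem amount_last : M.amount (M.n * (M.m + 2)) = 0 := by
  rw [amount, List.getD_eq_default]
  rw [length_amounts]

theorem entry_eq {k : ℕ} (hk : k ≤ M.n * (M.m + 2)) :
    (entry (M.cells E) (M.commonScale E) k : ℝ) = M.amount k * M.commonScale E := by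
  rcases Nat.lt_or_eq_of_le hk with hk | rfl
  · obtain ⟨u, hu, -⟩ := M.commonScale_eq E hk
    have hd : ((M.amount k).den : ℤ) ≠ 0 := by exact_mod_cast (M.amount k).den_nz
    rw [entry, cells_num, cells_den M E k hk, hu, Int.mul_ediv_cancel_left _ hd]
    push_cast
    rw [← mul_assoc]
    congr 1
    exact_mod_cast (Rat.mul_den_eq_num (M.amount k)).symm
  · rw [entry, cells_num, amount_last]
    simp

theorem dvd_entry {k d : ℕ} (hk : k ≤ M.n * (M.m + 2)) (h1 : 1 ≤ d) (hd : d ≤ M.n * (M.m + 2)) :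
    (d : ℤ) ∣ entry (M.cells E) (M.commonScale E) k := by
  rcases Nat.lt_or_eq_of_le hk with hk | rfl
  · obtain ⟨u, hu, h⟩ := M.commonScale_eq E hk
    have hd0 : ((M.amount k).den : ℤ) ≠ 0 := by exact_mod_cast (M.amount k).den_nz
    rw [entry, cells_den M E k hk, hu, Int.mul_ediv_cancel_left _ hd0]
    exact (h d h1 hd).mul_left _
  · rw [entry, cells_num, amount_last]
    simp

theorem candidate_index {a : ℤ → ℤ} {L : ℤ} {N m k₁ k₂ d : ℕ} (h1 : k₁ ≤ N) (h2 : k₂ ≤ N)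
    (hd : d ≤ m) : ∃ t < (N + 1) * (N + 1) * (m + 1),
      candidate a N m L t = (entry a L k₁ - entry a L k₂) / d := by
  -- The triple is read as the digits of a mixed-radix number.
  refine ⟨(m + 1) * ((N + 1) * k₁ + k₂) + d, ?_, ?_⟩
  · have h3 : (N + 1) * k₁ + k₂ + 1 ≤ (N + 1) * (N + 1) := by nlinarith
    calc (m + 1) * ((N + 1) * k₁ + k₂) + d < (m + 1) * ((N + 1) * k₁ + k₂ + 1) := by
          rw [mul_add _ _ 1]; omega
      _ ≤ (m + 1) * ((N + 1) * (N + 1)) := Nat.mul_le_mul_left _ h3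
      _ = _ := by ring
  · have e1 : ((m + 1) * ((N + 1) * k₁ + k₂) + d) / (m + 1) = (N + 1) * k₁ + k₂ := by
      rw [Nat.mul_add_div (by omega), Nat.div_eq_of_lt (by omega), add_zero]
    have e2 : ((m + 1) * ((N + 1) * k₁ + k₂) + d) % (m + 1) = d := by
      rw [Nat.mul_add_mod, Nat.mod_eq_of_lt (by omega)]
    have e3 : ((N + 1) * k₁ + k₂) / (N + 1) = k₁ := by
      rw [Nat.mul_add_div (by omega), Nat.div_eq_of_lt (by omega), add_zero]
    have e4 : ((N + 1) * k₁ + k₂) % (N + 1) = k₂ := by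
      rw [Nat.mul_add_mod, Nat.mod_eq_of_lt (by omega)]
    rw [candidate, e1, e2, e3, e4]

/-- The number of candidate prices. -/
abbrev rounds : ℕ := (M.n * (M.m + 2) + 1) * (M.n * (M.m + 2) + 1) * (M.m + 1)

abbrev scaledBudget : ℕ → ℤ := budgetAt (M.cells E) M.m (M.commonScale E)

abbrev scaledValue : ℕ → ℕ → ℤ := valueAt (M.cells E) M.m (M.commonScale E)

abbrev scaledCandidate : ℕ → ℤ := candidate (M.cells E) (M.n * (M.m + 2)) M.m (M.commonScale E)

theorem scaledBudget_eq (i : Fin M.n) :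
    (M.scaledBudget E i : ℝ) = M.budget i * M.commonScale E := by
  rw [scaledBudget, budgetAt, entry_eq M E (by gcongr; exact i.2.le), amount_budget]

theorem value_index_le {i y n m : ℕ} (hi : i < n) (hy : y ≤ m) :
    i * (m + 2) + 1 + y ≤ n * (m + 2) :=
  calc i * (m + 2) + 1 + y ≤ (i + 1) * (m + 2) := by rw [add_mul]; omega
    _ ≤ _ := Nat.mul_le_mul_right _ hi

theorem scaledValue_eq (i : Fin M.n) (y : Fin (M.m + 1)) :
    (M.scaledValue E i y : ℝ) = M.value i y * M.commonScale E := by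
  rw [scaledValue, valueAt, entry_eq M E (value_index_le i.2 (Nat.lt_succ_iff.1 y.2)), amount_value]

/-- With at least one buyer, `m` is below the number of amounts, so every divisor that occurs
divides the scaled amounts and the integer divisions in the candidates are exact. -/
theorem critical (i : ℕ) (hi : i < M.n) :
    Critical M.m (M.scaledBudget E i) (M.scaledValue E i) M.rounds (M.scaledCandidate E) := by
  have hN : M.m + 2 ≤ M.n * (M.m + 2) := Nat.le_mul_of_pos_left _ (by omega)
  constructor
  · intro y z hzy hy
    obtain ⟨t, ht, he⟩ := candidate_index (a := M.cells E) (L := M.commonScale E)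
      (value_index_le hi hy) (value_index_le hi (hzy.le.trans hy)) (show y - z ≤ M.m by omega)
    refine ⟨t, ht, ?_⟩
    rw [scaledCandidate, he, ← Nat.cast_sub hzy.le]
    exact Int.ediv_mul_cancel (dvd_sub (dvd_entry M E (value_index_le hi hy) (by omega) (by omega))
      (dvd_entry M E (value_index_le hi (hzy.le.trans hy)) (by omega) (by omega)))
  · intro y h1 hy
    have hb : i * (M.m + 2) ≤ M.n * (M.m + 2) := Nat.mul_le_mul_right _ hi.le
    obtain ⟨t, ht, he⟩ := candidate_index (a := M.cells E) (L := M.commonScale E) hb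
      (le_refl (M.n * (M.m + 2))) hy
    refine ⟨t, ht, ?_⟩
    have h0 : entry (M.cells E) (M.commonScale E) (M.n * (M.m + 2)) = 0 := by
      rw [entry, cells_num, amount_last]; simp
    rw [scaledCandidate, he, h0, sub_zero]
    exact Int.ediv_mul_cancel (dvd_entry M E hb h1 (by omega))

theorem exists_nonneg_candidate : ∃ t < M.rounds, 0 ≤ M.scaledCandidate E t :=
  -- Index 0 gives the candidate 0.
  ⟨0, by simp [rounds], by simp [scaledCandidate, candidate]⟩

theorem scaledBudget_nonneg (i : ℕ) (hi : i < M.n) : 0 ≤ M.scaledBudget E i := by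
  have h1 := M.scaledBudget_eq E ⟨i, hi⟩
  have h2 : (0 : ℝ) < M.budget ⟨i, hi⟩ := by exact_mod_cast M.budget_pos _
  have h3 : (0 : ℝ) < M.commonScale E := by exact_mod_cast M.commonScale_pos E
  have : (0 : ℝ) ≤ M.scaledBudget E i := h1 ▸ (by positivity)
  exact_mod_cast this

theorem scaledValue_zero_nonneg (i : ℕ) (hi : i < M.n) : 0 ≤ M.scaledValue E i 0 := by
  have h1 := M.scaledValue_eq E ⟨i, hi⟩ 0
  have h2 : (0 : ℝ) ≤ M.value ⟨i, hi⟩ 0 := by exact_mod_cast M.value_zero_nonneg _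
  have h3 : (0 : ℝ) < M.commonScale E := by exact_mod_cast M.commonScale_pos E
  have : (0 : ℝ) ≤ M.scaledValue E i 0 := by
    rw [Fin.val_zero] at h1
    exact h1 ▸ (by positivity)
  exact_mod_cast this

/-! ### Demand in the market and in the scaled market -/

theorem mem_demand_iff {i : Fin M.n} {p : ℝ} {y : Fin (M.m + 1)} :
    y ∈ M.demand i p ↔ p * (y : ℕ) ≤ M.budget i ∧ ∀ z : Fin (M.m + 1), p * (z : ℕ) ≤ M.budget i →
      (M.value i z : ℝ) - p * (z : ℕ) ≤ M.value i y - p * (y : ℕ) := by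
  simp only [demand, utility, Set.mem_ofPred_eq]
  refine and_congr_right fun hy => forall_congr' fun z => ?_
  rw [if_pos hy]
  split_ifs with hz
  · simp only [WithBot.coe_le_coe, hz, true_imp_iff]
  · simp [hz]

theorem mem_demand_iff_realDemanded {i : Fin M.n} {p : ℝ} {y : Fin (M.m + 1)} :
    y ∈ M.demand i p ↔ RealDemanded M.m (M.scaledBudget E i) (M.scaledValue E i)
      (p * M.commonScale E) y := by
  have h3 : (0 : ℝ) < M.commonScale E := by exact_mod_cast M.commonScale_pos E
  have hB : ∀ z : ℕ, p * M.commonScale E * z ≤ M.scaledBudget E i ↔ p * z ≤ M.budget i :=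
    fun z => by
      rw [scaledBudget_eq, mul_right_comm, mul_le_mul_iff_left₀ h3]
  have hV : ∀ z : Fin (M.m + 1), (M.scaledValue E i z : ℝ) - p * M.commonScale E * (z : ℕ) =
      (M.value i z - p * (z : ℕ)) * M.commonScale E := fun z => by
    rw [scaledValue_eq]; ring
  rw [mem_demand_iff, RealDemanded, hB]
  constructor
  · rintro ⟨h1, h2⟩
    refine ⟨Nat.lt_succ_iff.1 y.2, h1, fun z hz hzB => ?_⟩
    have := h2 ⟨z, Nat.lt_succ_of_le hz⟩ ((hB z).1 hzB)
    rw [hV, hV ⟨z, Nat.lt_succ_of_le hz⟩]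
    exact mul_le_mul_of_nonneg_right this h3.le
  · rintro ⟨-, h1, h2⟩
    refine ⟨h1, fun z hz => ?_⟩
    have := h2 z (Nat.lt_succ_iff.1 z.2) ((hB z).2 hz)
    rw [hV, hV] at this
    exact le_of_mul_le_mul_right this h3

/-- An allocation as a function on the natural numbers. -/
def Pricing.extend {M : Market} (q : M.Pricing) (j : ℕ) : ℕ :=
  if h : j < M.n then q.alloc ⟨j, h⟩ else 0

theorem Pricing.extend_val {M : Market} (q : M.Pricing) (i : Fin M.n) :
    q.extend i = q.alloc i := by
  simp [Pricing.extend]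

theorem sum_extend {A : Type*} [AddCommMonoid A] {M : Market} (q : M.Pricing) (h : ℕ → ℕ → A) :
    ∑ j ∈ range M.n, h j (q.extend j) = ∑ i : Fin M.n, h i (q.alloc i) := by
  rw [← Fin.sum_univ_eq_sum_range (fun j => h j (q.extend j))]
  simp only [Pricing.extend_val]

/-- The price `P / commonScale` with the allocation `x`. -/
noncomputable def scaledPricing (P : ℤ) (x : ℕ → ℕ) : M.Pricing where
  price := P / M.commonScale E
  alloc i := Fin.ofNat (M.m + 1) (x i)

variable {M E}

theorem scaledPricing_price_mul (P : ℤ) (x : ℕ → ℕ) :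
    (M.scaledPricing E P x).price * M.commonScale E = P := by
  have h3 : (0 : ℝ) < M.commonScale E := by exact_mod_cast M.commonScale_pos E
  exact div_mul_cancel₀ _ h3.ne'

/-- Demanded bundles have at most `m` units, so the reduction modulo `m + 1` in `Fin.ofNat` changes
nothing. -/
theorem scaledPricing_alloc {P : ℤ} {x : ℕ → ℕ}
    (hx : EnvyFreeAt (M.cells E) M.n M.m (M.commonScale E) P x) (i : Fin M.n) :
    ((M.scaledPricing E P x).alloc i : ℕ) = x i := by
  have := (hx.1 i i.2).1
  simp only [scaledPricing, Fin.val_ofNat]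
  exact Nat.mod_eq_of_lt (by omega)

theorem envyFree_scaledPricing {P : ℤ} (hP : 0 ≤ P) {x : ℕ → ℕ}
    (hx : EnvyFreeAt (M.cells E) M.n M.m (M.commonScale E) P x) :
    M.EnvyFree (M.scaledPricing E P x) := by
  have h3 : (0 : ℝ) < M.commonScale E := by exact_mod_cast M.commonScale_pos E
  have hP' : (0 : ℝ) ≤ P := by exact_mod_cast hP
  refine ⟨div_nonneg hP' h3.le, ?_, fun i => ?_⟩
  · simp only [scaledPricing_alloc hx]
    rw [Fin.sum_univ_eq_sum_range]
    exact hx.2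
  · rw [mem_demand_iff_realDemanded M E, scaledPricing_price_mul, scaledPricing_alloc hx,
      realDemanded_intCast]
    exact hx.1 i i.2

theorem EnvyFree.exists_candidate {q : M.Pricing} (hq : M.EnvyFree q) :
    ∃ t < M.rounds, 0 ≤ M.scaledCandidate E t ∧
      EnvyFreeAt (M.cells E) M.n M.m (M.commonScale E) (M.scaledCandidate E t) q.extend ∧
      (q.price * M.commonScale E ≤ M.scaledCandidate E t ∨ ∀ i, (q.alloc i : ℕ) = 0) := by
  have h3 : (0 : ℝ) < M.commonScale E := by exact_mod_cast M.commonScale_pos E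
  obtain ⟨t, ht, h0, h1, h2⟩ := _root_.exists_candidate (M.critical E) (M.scaledBudget_nonneg E)
    (M.exists_nonneg_candidate E) (mul_nonneg hq.1 h3.le) (x := q.extend) fun i hi => by
      have := (mem_demand_iff_realDemanded M E).1 (hq.2.2 ⟨i, hi⟩)
      rwa [← q.extend_val] at this
  refine ⟨t, ht, h0, ⟨h1, ?_⟩, h2.imp_right fun h i => ?_⟩
  · exact (sum_extend q fun _ y => y).trans_le hq.2.1
  · rw [← q.extend_val]
    exact h i i.2

variable (M E)

/-- This guarantees that the search does not end with the sentinel. -/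
theorem exists_envyFreeAt : ∃ t < M.rounds, 0 ≤ M.scaledCandidate E t ∧
    EnvyFreeAt (M.cells E) M.n M.m (M.commonScale E) (M.scaledCandidate E t) fun _ => 0 := by
  obtain ⟨t, ht, h0, h1⟩ := exists_candidate_zero (M.critical E) (M.scaledBudget_nonneg E)
    (M.exists_nonneg_candidate E)
  exact ⟨t, ht, h0, h1, by simp⟩

end Market

namespace RAM
open Finset

/-! ### Resource bounds -/

theorem bits_le_inputSize {w : List ℤ} {z : ℤ} (hz : z ∈ w) : bits z + 1 ≤ inputSize w :=
  List.single_le_sum (fun _ _ => Nat.zero_le _) _ (List.mem_map_of_mem (f := fun z => bits z + 1) hz)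

theorem length_le_inputSize (w : List ℤ) : w.length ≤ inputSize w := by
  induction w with
  | nil => simp
  | cons z w ih => simp [inputSize] at ih ⊢; omega

theorem bdd_initial {w : List ℤ} {K : ℕ} (hl : (w.length : ℤ) < 2 ^ K)
    (hw : ∀ z ∈ w, |z| < 2 ^ K) : Bdd K (State.initial w) := by
  have h0 : |(0 : ℤ)| < 2 ^ K := by simp
  constructor
  · intro r
    simp only [State.initial]
    split_ifs
    · rwa [abs_of_nonneg (Int.natCast_nonneg _)]
    · exact h0
  · intro a k
    simp only [State.initial]
    split_ifs
    · rcases lt_or_ge k.toNat w.length with h | h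
      · rw [List.getD_eq_getElem _ _ h]
        exact hw _ (List.getElem_mem h)
      · rwa [List.getD_eq_default _ _ h]
    · exact h0

/-- Bound on the number of rounds of every loop, for an input of size `S`. -/
def roundBound (S : ℕ) : ℕ := (S + 1) ^ 3

/-- Bound on the number of bits of all contents. -/
def bitBound (S E : ℕ) : ℕ := 2 * S * S + 4 * S + 4 + E

theorem two_pow_le_bitBound {S E e : ℕ} (h : e ≤ 2 * S * S + 4 * S + 3) :
    (2 : ℤ) ^ e < 2 ^ bitBound S E :=
  pow_lt_pow_right₀ (by norm_num) (by rw [bitBound]; omega)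

end RAM

namespace Market
open Finset RAM
variable (M : Market) (E : ℕ)

/-- Bit length of the market. -/
abbrev size : ℕ := inputSize M.encode

theorem n_mul_le_size : M.n * (M.m + 2) ≤ M.size := by
  have := length_le_inputSize M.encode
  rw [length_encode] at this
  rw [size]
  omega

theorem cells_mem (k : ℤ) (hk : k ≠ 0) : M.cells E k = 0 ∨ M.cells E k ∈ M.encode := by
  simp only [cells, State.initial]
  split_ifs with h
  · obtain ⟨j, hj⟩ : ∃ j, k.toNat = j + 1 := ⟨k.toNat - 1, by omega⟩
    rw [hj, List.getD_cons_succ]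
    rcases lt_or_ge j M.encode.length with h | h
    · rw [List.getD_eq_getElem _ _ h]
      exact Or.inr (List.getElem_mem h)
    · exact Or.inl (List.getD_eq_default _ _ h)
  · exact Or.inl rfl

theorem abs_lt_of_mem {z : ℤ} (hz : z ∈ M.encode) : |z| < 2 ^ M.size :=
  bits_le_iff.1 ((Nat.le_succ _).trans (bits_le_inputSize hz))

theorem abs_cells_lt (k : ℤ) (hk : k ≠ 0) : |M.cells E k| < 2 ^ M.size := by
  rcases M.cells_mem E k hk with h | h
  · rw [h]; simp
  · exact M.abs_lt_of_mem h

theorem lt_two_pow_int (k : ℕ) : (k : ℤ) < 2 ^ k := by exact_mod_cast k.lt_two_pow_self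

/-- There are at most `M.size` rounds, each multiplying by a denominator and a counter of at most
`M.size` bits each. -/
theorem abs_scale_le {k : ℕ} (hk : k ≤ M.n * (M.m + 2)) :
    |scale (M.cells E) k| ≤ 2 ^ (2 * M.size * M.size) := by
  have h1 : |scale (M.cells E) k| ≤ (2 ^ (2 * M.size)) ^ k := by
    rw [scale, abs_prod]
    refine (prod_le_prod (fun _ _ => abs_nonneg _) (g := fun _ => 2 ^ (2 * M.size))
      fun j hj => ?_).trans (by simp)
    have hj' : j + 1 ≤ M.size := by
      have := M.n_mul_le_size
      have := mem_range.1 hj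
      omega
    rw [abs_mul, two_mul M.size, pow_add]
    refine mul_le_mul (M.abs_cells_lt E _ (by omega)).le ?_ (abs_nonneg _) (by positivity)
    rw [abs_of_nonneg (by positivity)]
    have h2 : ((j + 1 : ℕ) : ℤ) ≤ M.size := by exact_mod_cast hj'
    push_cast at h2
    exact h2.trans (lt_two_pow_int _).le
  refine h1.trans ?_
  rw [← pow_mul]
  exact pow_le_pow_right₀ (by norm_num) (Nat.mul_le_mul_left _ (hk.trans M.n_mul_le_size))

/-- A scaled amount is a numerator below `2 ^ M.size` times a quotient of the scale. The number of
candidates is cubic in the size because a buyer forces `M.m ≤ M.size`. -/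
theorem bounds (hn : 0 < M.n) : Bounds (M.cells E) M.n M.m (M.commonScale E)
    (2 ^ (2 * M.size * M.size + M.size)) (roundBound M.size) (bitBound M.size E) := by
  refine ⟨fun k _ => ?_, ?_, ?_, M.scaledBudget_nonneg E, M.scaledValue_zero_nonneg E⟩
  · rw [entry, abs_mul, pow_add, mul_comm]
    exact mul_le_mul ((Int.abs_ediv_le_abs _ _).trans (M.abs_scale_le E le_rfl))
      (M.abs_cells_lt E _ (by omega)).le (abs_nonneg _) (by positivity)
  · have h1 := M.n_mul_le_size
    have h2 : M.m + 2 ≤ M.n * (M.m + 2) := Nat.le_mul_of_pos_left _ hn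
    rw [roundBound, pow_succ, sq]
    gcongr
    omega
  · have h1 : (M.size : ℤ) + 1 ≤ 2 ^ M.size := lt_two_pow_int M.size
    have h2 : (roundBound M.size : ℤ) ≤ 2 ^ (3 * M.size) := by
      rw [roundBound, mul_comm, pow_mul]
      push_cast
      gcongr
    have h3 : (1 : ℤ) ≤ 2 ^ (3 * M.size) := one_le_pow₀ (by norm_num)
    have h4 : (1 : ℤ) ≤ 2 ^ (2 * M.size * M.size + M.size) := one_le_pow₀ (by norm_num)
    calc ((roundBound M.size : ℤ) + 3) * (2 ^ (2 * M.size * M.size + M.size) + 1)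
        ≤ (4 * 2 ^ (3 * M.size)) * (2 * 2 ^ (2 * M.size * M.size + M.size)) := by
          gcongr <;> linarith
      _ = 2 ^ (2 * M.size * M.size + 4 * M.size + 3) := by ring
      _ < _ := two_pow_le_bitBound le_rfl

theorem bdd_initial : Bdd (bitBound M.size E) (State.initial ((E : ℤ) :: M.encode)) := by
  have hS := lt_two_pow_int M.size
  refine RAM.bdd_initial ?_ fun z hz => ?_
  · have h1 := length_le_inputSize M.encode
    have h2 : (2 : ℤ) ^ (M.size + 1) < 2 ^ bitBound M.size E := two_pow_le_bitBound (by omega)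
    have h3 : ((M.encode.length : ℕ) : ℤ) ≤ M.size := by exact_mod_cast h1
    have h4 : (1 : ℤ) ≤ 2 ^ M.size := one_le_pow₀ (by norm_num)
    rw [pow_succ] at h2
    push_cast [List.length_cons]
    linarith
  · rcases List.mem_cons.1 hz with rfl | hz
    · rw [abs_of_nonneg (Int.natCast_nonneg _)]
      exact (lt_two_pow_int E).trans_le (pow_le_pow_right₀ (by norm_num) (by rw [bitBound]; omega))
    · exact (M.abs_lt_of_mem hz).trans (two_pow_le_bitBound (by omega))

end Market

namespace RAM

theorem time_le {a d : ℕ} {c : Cmd} (hc : ∀ R, c.work R ≤ a * (R + 1) ^ d) {S E t : ℕ} {ε : ℝ}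
    (hε : 0 < ε) (hE : E = ⌈1 / ε⌉₊) (ht : t ≤ c.work (roundBound S) * (bitBound S E + 1)) :
    (t : ℝ) ≤ (12 * a * 2 ^ d : ℕ) * ((S : ℝ) + 1 / ε + 1) ^ (3 * d + 2) := by
  have hε' : 0 < 1 / ε := by positivity
  have hS : (0 : ℝ) ≤ S := Nat.cast_nonneg S
  have hX : 1 ≤ (S : ℝ) + 1 / ε + 1 := by linarith
  have hSX : (S : ℝ) + 1 ≤ (S : ℝ) + 1 / ε + 1 := by linarith
  have hEX : (E : ℝ) ≤ (S : ℝ) + 1 / ε + 1 := by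
    rw [hE]; linarith [Nat.ceil_lt_add_one hε'.le]
  generalize (S : ℝ) + 1 / ε + 1 = X at *
  have h1 : ((roundBound S : ℝ) + 1) ≤ 2 * X ^ 3 := by
    have h2 : (roundBound S : ℝ) ≤ X ^ 3 := by
      rw [roundBound]; push_cast; gcongr
    linarith [one_le_pow₀ hX (n := 3)]
  -- The constant is the sum of the coefficients `2 + 4 + 5 + 1` of `S * S`, `S`, `1` and `E`.
  have h2 : ((bitBound S E : ℝ) + 1) ≤ 12 * X ^ 2 := by
    rw [bitBound]; push_cast
    nlinarith
  calc (t : ℝ) ≤ c.work (roundBound S) * (bitBound S E + 1) := by exact_mod_cast ht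
    _ ≤ (a * (roundBound S + 1) ^ d) * (bitBound S E + 1) := by
      gcongr
      exact_mod_cast hc _
    _ ≤ (a * (2 * X ^ 3) ^ d) * (12 * X ^ 2) := by gcongr
    _ = _ := by push_cast; rw [mul_pow, ← pow_mul, pow_add]; ring

end RAM

/-! ### The approximation schemes -/

namespace Market
open Finset RAM

/-- The problem of maximizing `obj` over the envy-free pricings. -/
noncomputable def problem (obj : (M : Market) → M.Pricing → ℝ) : MaxProblem where
  Inst := Market
  Sol := Pricing
  input := encode
  Represents := Represents
  Feasible := EnvyFree
  objective := obj

/-- The objective `obj` is a sum of gains `g a m L P i y` that `gain` evaluates. -/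
structure IsGain (obj : (M : Market) → M.Pricing → ℝ) (gain : Expr)
    (g : (ℤ → ℤ) → ℕ → ℤ → ℤ → ℕ → ℕ → ℤ) : Prop where
  spec : ∀ {a n m L H R K}, Bounds a n m L H R K → GainSpec gain (g a m L) a n m L H
  obj_eq : ∀ (M : Market) (E : ℕ) (P : ℤ) (q : M.Pricing), q.price * M.commonScale E = P →
    obj M q * M.commonScale E =
      ((∑ i : Fin M.n, g (M.cells E) M.m (M.commonScale E) P i (q.alloc i) : ℤ) : ℝ)
  obj_le : ∀ (M : Market) (E : ℕ) (P : ℤ) (q : M.Pricing),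
    (q.price * M.commonScale E ≤ P ∨ ∀ i, (q.alloc i : ℕ) = 0) → obj M q * M.commonScale E ≤
      ((∑ i : Fin M.n, g (M.cells E) M.m (M.commonScale E) P i (q.alloc i) : ℤ) : ℝ)
  nonneg : ∀ (M : Market) (q : M.Pricing), M.EnvyFree q → 0 ≤ obj M q

theorem exists_exec_zero (M : Market) (E : ℕ) (hn : M.n = 0) (gain : Expr) :
    ∃ s t w x, Exec (mainCmd gain) (State.initial ((E : ℤ) :: M.encode)) s t ∧
      t ≤ (mainCmd gain).work (roundBound M.size) * (bitBound M.size E + 1) ∧ s.Outputs w ∧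
      M.Represents w x ∧ M.EnvyFree x := by
  have h1 : (State.initial ((E : ℤ) :: M.encode)).arr 0 1 = 0 := by
    have := M.cells_one E
    rwa [hn] at this
  obtain ⟨s, t, he, ht, -, h2, h3, h4⟩ := runs_mainCmd_zero (gain := gain) (R := roundBound M.size) h1
    ((M.bdd_initial E).2 0 2) (by rw [bitBound]; omega) (by simp [State.initial]) (M.bdd_initial E)
  have : IsEmpty (Fin M.n) := by rw [hn]; infer_instance
  refine ⟨s, t, [0, 1], ⟨0, isEmptyElim⟩, he, ht, ⟨by simpa using h2, fun k hk => ?_⟩,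
    ⟨0, 1, by norm_num, by simp, by simp [hn]⟩, by simp, by simp, fun i => isEmptyElim i⟩
  match k, hk with
  | 0, _ => simpa using h3
  | 1, _ => simpa using h4

theorem exists_exec_pos (M : Market) (E : ℕ) (hn : 0 < M.n)
    {obj : (M : Market) → M.Pricing → ℝ} {gain : Expr}
    {g : (ℤ → ℤ) → ℕ → ℤ → ℤ → ℕ → ℕ → ℤ} (h : IsGain obj gain g) :
    ∃ s t w x, Exec (mainCmd gain) (State.initial ((E : ℤ) :: M.encode)) s t ∧
      t ≤ (mainCmd gain).work (roundBound M.size) * (bitBound M.size E + 1) ∧ s.Outputs w ∧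
      M.Represents w x ∧ M.EnvyFree x ∧
      ∀ y, M.EnvyFree y → obj M y ≤ obj M x := by
  have hb := M.bounds E hn
  have hG := h.spec hb
  have hL : (0 : ℝ) < M.commonScale E := by exact_mod_cast M.commonScale_pos E
  obtain ⟨s, t, he, ht, -, h0, hF⟩ := runs_mainCmd_pos (s := State.initial ((E : ℤ) :: M.encode))
    rfl (M.cells_one E) (M.cells_two E) hn hb hG (fun k hk =>
      (M.abs_scale_le E hk).trans_lt (two_pow_le_bitBound (by omega)))
    (by simp [State.initial]) (M.bdd_initial E)
  obtain hF1 | ⟨P, x, hP, h2, h3, h4, hx, hsum⟩ := hF.attained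
  -- Selling nothing at a suitable candidate price has nonnegative gain, which contradicts a final
  -- objective of `-1`.
  · obtain ⟨u, hu, hu0, hef⟩ := M.exists_envyFreeAt E
    have := hF.upper _ ⟨hu0, u, hu, rfl⟩ _ hef
    have := hG.sum_nonneg hu0 hef
    omega
  have hobj : obj M (M.scaledPricing E P x) * M.commonScale E = (s.reg 15 : ℝ) := by
    rw [h.obj_eq M E P _ (scaledPricing_price_mul P x), ← hsum]
    simp only [scaledPricing_alloc hx]
    rw [Fin.sum_univ_eq_sum_range (fun i => g (M.cells E) M.m (M.commonScale E) P i (x i))]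
  refine ⟨s, t, P :: M.commonScale E :: List.ofFn fun i : Fin M.n => (x i : ℤ),
    M.scaledPricing E P x, he, ht, ⟨?_, fun k hk => ?_⟩,
    ⟨P, M.commonScale E, M.commonScale_pos E, rfl, ?_⟩, envyFree_scaledPricing hP hx, ?_⟩
  · rw [h0]; simp; ring
  · match k, hk with
    | 0, _ => simpa using h2
    | 1, _ => exact h3
    | k + 2, hk =>
      have hk' : k < M.n := by simpa using hk
      have := h4 k hk'
      rw [add_comm] at this
      simpa using this
  · simp only [scaledPricing_alloc hx]
  · intro y hy
    obtain ⟨u, hu, hu0, hef, hle⟩ := hy.exists_candidate (E := E)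
    refine le_of_mul_le_mul_right ((h.obj_le M E _ y hle).trans ?_) hL
    rw [hobj, ← sum_extend y]
    exact_mod_cast hF.upper _ ⟨hu0, u, hu, rfl⟩ _ hef

/-- An exact optimum also meets the factor `1 - ε`, because the objective is nonnegative on
envy-free pricings. -/
theorem hasFPTAS {obj : (M : Market) → M.Pricing → ℝ} {gain : Expr}
    {g : (ℤ → ℤ) → ℕ → ℤ → ℤ → ℕ → ℕ → ℤ} (h : IsGain obj gain g)
    (h0 : ∀ (M : Market) (q : M.Pricing), M.n = 0 → obj M q = 0) : (problem obj).HasFPTAS := by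
  obtain ⟨a, d, hw⟩ := (mainCmd gain).work_le_pow
  refine ⟨mainCmd gain, 12 * a * 2 ^ d, 3 * d + 2, fun M ε hε => ?_⟩
  rcases Nat.eq_zero_or_pos (Market.n M) with hn | hn
  · obtain ⟨s, t, w, x, he, ht, ho, hr, hf⟩ := exists_exec_zero M ⌈1 / ε⌉₊ hn gain
    refine ⟨s, t, w, x, he, time_le hw hε rfl ht, ho, hr, hf, fun y _ => ?_⟩
    change (1 - ε) * obj M y ≤ obj M x
    rw [h0 M x hn, h0 M y hn, mul_zero]
  · obtain ⟨s, t, w, x, he, ht, ho, hr, hf, hle⟩ := exists_exec_pos M ⌈1 / ε⌉₊ hn h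
    refine ⟨s, t, w, x, he, time_le hw hε rfl ht, ho, hr, hf, fun y hy => ?_⟩
    have hy' : M.EnvyFree y := hy
    have hyx := hle y hy
    change (1 - ε) * obj M y ≤ obj M x
    nlinarith [h.nonneg M y hy']

/-- Zero units are always affordable and worth a nonnegative amount. A demanded bundle has at least
that utility, and its value is its utility plus a nonnegative payment. -/
theorem nonneg_of_envyFree {M : Market} {q : M.Pricing} (hq : M.EnvyFree q) (i : Fin M.n) :
    (0 : ℝ) ≤ M.value i (q.alloc i) := by
  have h1 := ((M.mem_demand_iff).1 (hq.2.2 i)).2 0 (by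
    simpa using (M.budget_pos i).le)
  have h2 : (0 : ℝ) ≤ M.value i 0 := by exact_mod_cast M.value_zero_nonneg i
  have h3 : 0 ≤ q.price * (q.alloc i : ℕ) := mul_nonneg hq.1 (Nat.cast_nonneg _)
  simp only [Fin.val_zero, Nat.cast_zero, mul_zero, sub_zero] at h1
  linarith

theorem isGain_welfare :
    IsGain welfare (valueE (.reg 11)) fun a m L _ i y => valueAt a m L i y where
  spec hb :=
    { eval := fun _ _ _ _ hE _ h9 h11 => hE.eval_valueE h9 h11
      nonneg := fun P i y hP hi hD => by
        have h1 := hD.price_mul_le_value (hb.budget_nonneg i hi) (hb.value_nonneg i hi)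
        have : 0 ≤ P * y := by positivity
        exact this.trans h1
      le := fun P i y _ hi hD => (abs_le.1 (hb.abs_value_le hi hD.1)).2 }
  obj_eq M E P q _ := by
    push_cast
    rw [welfare, sum_mul]
    exact sum_congr rfl fun i _ => (M.scaledValue_eq E i _).symm
  obj_le M E P q _ := by
    push_cast
    rw [welfare, sum_mul]
    exact (sum_congr rfl fun i _ => (M.scaledValue_eq E i _).symm).le
  nonneg M q hq := sum_nonneg fun i _ => nonneg_of_envyFree hq i

theorem isGain_revenue :
    IsGain revenue (.reg 8 * .reg 11) fun _ _ _ P _ y => P * y where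
  spec hb :=
    { eval := fun s P _ _ _ h8 _ h11 => by simp [h8, h11]
      nonneg := fun P i y hP _ _ => by positivity
      le := fun P i y _ hi hD => hD.2.1.trans (abs_le.1 (hb.abs_budget_le hi)).2 }
  obj_eq M E P q h := by
    push_cast
    rw [revenue, sum_mul]
    exact sum_congr rfl fun i _ => by rw [← h]; ring
  obj_le M E P q h := by
    push_cast
    rw [revenue, sum_mul]
    refine sum_le_sum fun i _ => ?_
    -- Either the candidate price is not lower than the original one, or nothing is sold and both
    -- revenues vanish.
    rcases h with h | h
    · rw [mul_assoc, mul_comm]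
      gcongr
    · simp [h i]
  nonneg M q hq := sum_nonneg fun i _ => mul_nonneg (Nat.cast_nonneg _) hq.1

end Market

theorem mainTheorem10 : welfareProblem.HasFPTAS ∧ revenueProblem.HasFPTAS := by
  have h : ∀ M : Market, M.n = 0 → IsEmpty (Fin M.n) := fun M hn => by rw [hn]; infer_instance
  exact ⟨Market.hasFPTAS Market.isGain_welfare fun M q hn => by
      have := h M hn; simp [Market.welfare],
    Market.hasFPTAS Market.isGain_revenue fun M q hn => by
      have := h M hn; simp [Market.revenue]⟩
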